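/- **Setting.** In the impartial octal game $\mathbf{0.33}$ (normal play) on a finite graph, a move removes one vertex, or two adjacent vertices, of a connected component without disconnecting that component (removing the whole component is allowed). The Grundy value $\mathcal G(J)$ of a position $J$ is the least nonnegative integer that is not the Grundy value of an option of $J$, and $J_1\equiv J_2$ means that the disjoint sum $J_1+J_2$ is a win for the second player. Let $\oplus$ be the nim-sum (bitwise XOR). A *subdivided star* is either the empty graph $\emptyset$ or $S_{\ell_1,\dots,\ell_k}$ ($k\ge 0$, all $\ell_i\ge 1$), the tree made of a central vertex with $k$ paths attached to it, the $i$-th path having $\ell_i$ vertices; it is considered together with its central vertex. In particular $P_1$ is the star with $k=0$ and $P_2=S_1$. For subdivided stars $S,S'$, the bistar $S\!-\!S'$ is obtained from the disjoint union of $S$ and $S'$ by joining the two central vertices by an edge; if one of them is empty it is the other one. Write $S\sim_1 S'$ if $S\!-\!\hat S\equiv S'\!-\!\hat S$ for every subdivided star $\hat S$ (including $\emptyset$). The *reduction* $\bar S$ of a subdivided star $S$ is obtained by replacing each path length $\ell_i$ by $\ell_i \bmod 3$ and deleting the paths whose length becomes $0$ (and $\bar\emptyset=\emptyset$). Define the following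 sets of subdivided stars: * $\mathcal C_1^*$: those $S$ with $\bar S\in\{P_1,S_{2,1},S_{2,2,2}\}$; * $\mathcal C_2^*$: those $S$ with $\bar S\in\{P_2,S_{2,2}\}$; * $\mathcal C_i^{\Box}$ for $i\in\{2,3\}$: those $S$ with $\mathcal G(S)=i$ such that $\bar S$ has exactly one or exactly three paths of length $2$; * $\mathcal C_i$ for $i\in\{0,1,2,3\}$: those $S$ with $\mathcal G(S)=i$ that belong to none of $\mathcal C_1^*,\mathcal C_2^*,\mathcal C_2^\Box,\mathcal C_3^\Box$. **Theorem.** The relation $\sim_1$ is an equivalence relation on subdivided stars, and its equivalence classes are exactly the eight pairwise distinct sets $\mathcal C_0,\mathcal C_1,\mathcal C_1^*,\mathcal C_2,\mathcal C_2^*,\mathcal C_2^\Box,\mathcal C_3,\mathcal C_3^\Box$. Moreover, for all subdivided stars $S,S'$, $$\mathcal G(S\!-\!S')=\begin{cases} 2 & \text{if } S,S'\in\mathcal C_1^*,\\ 0 & \text{if one of } S,S' \text{ is in } \mathcal C_1^* \text{ and the other in } \mathcal C_2^*,\\ 1 & \text{if } S,S'\in\mathcal C_2^*,\\ 1 & \text{if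 one of } S,S' \text{ is in } \mathcal C_2^* \text{ and the other in } \mathcal C_2^\Box,\\ 0 & \text{if one of } S,S' \text{ is in } \mathcal C_2^* \text{ and the other in } \mathcal C_3^\Box,\\ \mathcal G(S)\oplus\mathcal G(S') & \text{otherwise.} \end{cases}$$ -/

import Mathlib

/-! ### Impartial games in normal play -/

/-- A (finite) impartial game on a type of positions `P`; `Opt J J'` says that `J'` is an option
of `J`. -/
structure ImpartialGame (P : Type) where
  Opt : P → P → Prop
  wf : WellFounded (fun J' J => Opt J J')
  finite_opt : ∀ J, {J' | Opt J J'}.Finite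

namespace ImpartialGame

variable {P Q : Type}

/-- `J` is a `𝒫`-position (the previous player wins): no option of `J` is a `𝒫`-position. -/
def IsPPosition (g : ImpartialGame P) : P → Prop :=
  g.wf.fix fun J ih => ∀ J' (h : g.Opt J J'), ¬ ih J' h

/-- The Grundy value of a position: the least natural number which is not the Grundy value of an
option. -/
noncomputable def grundy (g : ImpartialGame P) : P → ℕ :=
  g.wf.fix fun J ih => sInf {n | ∀ J' (h : g.Opt J J'), ih J' h ≠ n}

theorem isPPosition_iff (g : ImpartialGame P) (J : P) :
    g.IsPPosition J ↔ ∀ J', g.Opt J J' → ¬ g.IsPPosition J' := by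
  unfold IsPPosition
  rw [g.wf.fix_eq]

theorem grundy_eq (g : ImpartialGame P) (J : P) :
    g.grundy J = sInf {n | ∀ J', g.Opt J J' → g.grundy J' ≠ n} := by
  unfold grundy
  rw [g.wf.fix_eq]

/-- The disjoint sum of two games: a move is a move in exactly one of the two components. -/
def sum (g : ImpartialGame P) (h : ImpartialGame Q) : ImpartialGame (P × Q) where
  Opt J J' := (g.Opt J.1 J'.1 ∧ J'.2 = J.2) ∨ (J'.1 = J.1 ∧ h.Opt J.2 J'.2)
  wf := by
    refine Subrelation.wf ?_ (g.wf.prod_gameAdd h.wf)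
    rintro ⟨a', b'⟩ ⟨a, b⟩ (⟨h1, h2⟩ | ⟨h1, h2⟩)
    · cases h2
      exact Prod.GameAdd.fst h1
    · cases h1
      exact Prod.GameAdd.snd h2
  finite_opt := by
    rintro ⟨a, b⟩
    refine (((g.finite_opt a).prod (Set.finite_singleton b)).union
      ((Set.finite_singleton a).prod (h.finite_opt b))).subset ?_
    rintro ⟨a', b'⟩ (⟨h1, h2⟩ | ⟨h1, h2⟩)
    · exact Or.inl ⟨h1, h2⟩
    · exact Or.inr ⟨h1, h2⟩

/-- The equivalence `J ≡ K` of two game positions: `J + K` is a `𝒫`-position. -/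
def Equivalent (g : ImpartialGame P) (J : P) (h : ImpartialGame Q) (K : Q) : Prop :=
  (g.sum h).IsPPosition (J, K)

end ImpartialGame

/-! ### Octal games on graphs -/

section Octal

variable {V : Type} [DecidableEq V]

/-- The vertices of `G[A]` in the connected component(s) of `G[A]` meeting `X`. -/
def componentOf (G : SimpleGraph V) (A X : Finset V) : Set V :=
  {v | ∃ x ∈ X, ∃ (hx : x ∈ (A : Set V)) (hv : v ∈ (A : Set V)),
    (G.induce (A : Set V)).Reachable ⟨x, hx⟩ ⟨v, hv⟩}

/-- In the octal game `0.u₁u₂…` played on the graph `G[A]`, it is legal to remove the set `X` of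
vertices: `X` induces a connected graph, and, `H` being the component of `G[A]` containing `X` and
`u_i = b₁ + 2 b₂ + 4 b₃` with `i = |X|`, either `X = H` and `b₁ = 1`, or `H \ X` is nonempty and
connected and `b₂ = 1`, or `H \ X` is disconnected and `b₃ = 1`. -/
def OctalLegal (u : ℕ → Fin 8) (G : SimpleGraph V) (A X : Finset V) : Prop :=
  X ⊆ A ∧ (G.induce (X : Set V)).Connected ∧
    ((componentOf G A X \ X = ∅ ∧ (u X.card).val.testBit 0 = true) ∨
     ((G.induce (componentOf G A X \ X)).Connected ∧ (u X.card).val.testBit 1 = true) ∨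
     ((componentOf G A X \ X).Nonempty ∧ ¬ (G.induce (componentOf G A X \ X)).Connected ∧
        (u X.card).val.testBit 2 = true))

/-- The octal game with code `u` on the graph `G`. The finite set `A` of remaining vertices stands
for the position `G[A]`. -/
def octalGame (u : ℕ → Fin 8) (G : SimpleGraph V) : ImpartialGame (Finset V) where
  Opt A B := ∃ X, OctalLegal u G A X ∧ B = A \ X
  wf := by
    refine Subrelation.wf ?_ (Finset.isWellFounded_ssubset (α := V)).wf
    rintro B A ⟨X, ⟨hXA, hX, -⟩, rfl⟩
    obtain ⟨⟨x, hx⟩⟩ := hX.nonempty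
    have hx' : x ∈ X := hx
    exact Finset.sdiff_ssubset hXA ⟨x, hx'⟩
  finite_opt := by
    intro A
    refine (A.powerset.finite_toSet).subset ?_
    rintro B ⟨X, -, rfl⟩
    simp

/-- The code of the octal game `0.33`. -/
def code033 : ℕ → Fin 8 := fun i => if i = 1 ∨ i = 2 then 3 else 0

/-- The Grundy value of the game `0.33` on a finite graph. -/
noncomputable def grundy033 [Fintype V] (G : SimpleGraph V) : ℕ :=
  (octalGame code033 G).grundy Finset.univ

end Octal

/-- `G ≡ H` for the game `0.33` played on two finite graphs. -/
def Equivalent033 {V W : Type} [DecidableEq V] [Fintype V] [DecidableEq W] [Fintype W]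
    (G : SimpleGraph V) (H : SimpleGraph W) : Prop :=
  (octalGame code033 G).Equivalent Finset.univ (octalGame code033 H) Finset.univ

/-! ### Subdivided stars and bistars -/

/-- The edges of the spider with legs of lengths `len i`, oriented away from the centre `none`;
`some ⟨i, j⟩` is the vertex at distance `j + 1` from the centre on the leg `i`. -/
inductive SpiderEdge {ι : Type} (len : ι → ℕ+) :
    Option (Σ i, Fin (len i)) → Option (Σ i, Fin (len i)) → Prop
  | first (i : ι) (j : Fin (len i)) (hj : j.val = 0) : SpiderEdge len none (some ⟨i, j⟩)
  | next (i : ι) (j k : Fin (len i)) (hjk : k.val = j.val + 1) :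
      SpiderEdge len (some ⟨i, j⟩) (some ⟨i, k⟩)

/-- The star with one edge for each `i : ι`, in which the edge `i` is replaced with a path having
`len i` vertices besides the centre. -/
def spider {ι : Type} (len : ι → ℕ+) : SimpleGraph (Option (Σ i, Fin (len i))) :=
  SimpleGraph.fromRel (SpiderEdge len)

/-- A subdivided star: either the empty graph, or `S_{ℓ₁,…,ℓₖ}` with `k ≥ 0` and all `ℓᵢ ≥ 1`,
given by the multiset of the `ℓᵢ`. In particular `star 0` is `P₁` and `star {1}` is `P₂`. -/
inductive SubdividedStar : Type
  | empty : SubdividedStar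
  | star (arms : Multiset ℕ+) : SubdividedStar

namespace SubdividedStar

/-- The vertices of a star. The paths of `S_{ℓ₁,…,ℓₖ}` are indexed by the pairs `(ℓ, i)` where `i`
is less than the multiplicity of `ℓ`. -/
abbrev Vertex : SubdividedStar → Type
  | empty => Empty
  | star arms => Option (Σ p : arms.toEnumFinset, Fin p.1.1)

instance (S : SubdividedStar) : DecidableEq S.Vertex :=
  match S with
  | empty => inferInstanceAs (DecidableEq Empty)
  | star arms => inferInstanceAs (DecidableEq (Option (Σ p : arms.toEnumFinset, Fin p.1.1)))

instance (S : SubdividedStar) : Fintype S.Vertex :=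
  match S with
  | empty => inferInstanceAs (Fintype Empty)
  | star arms => inferInstanceAs (Fintype (Option (Σ p : arms.toEnumFinset, Fin p.1.1)))

/-- The underlying graph of a subdivided star. -/
def graph : (S : SubdividedStar) → SimpleGraph S.Vertex
  | empty => (⊥ : SimpleGraph Empty)
  | star arms => spider (fun p : arms.toEnumFinset => p.1.1)

/-- The vertex is the central vertex of the star (the empty graph has none). -/
def IsCenter : (S : SubdividedStar) → S.Vertex → Prop
  | empty => fun _ => False
  | star _ => fun v => v = none

/-- The bistar `S–S'` with a middle path of length 1: the disjoint union of `S` and `S'` with an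
edge joining the two central vertices; it is just the other star if one of them is empty. -/
def bistar (S S' : SubdividedStar) : SimpleGraph (S.Vertex ⊕ S'.Vertex) :=
  (S.graph ⊕g S'.graph) ⊔
    SimpleGraph.fromRel (fun x y => ∃ c c', S.IsCenter c ∧ S'.IsCenter c' ∧
      x = Sum.inl c ∧ y = Sum.inr c')

/-- The Grundy value of the game `0.33` on a subdivided star. -/
noncomputable def grundy (S : SubdividedStar) : ℕ := grundy033 S.graph

/-- `S ∼₁ S'`: for every subdivided star `Ŝ`, `S–Ŝ ≡ S'–Ŝ`. -/
def Sim1 (S S' : SubdividedStar) : Prop :=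
  ∀ T : SubdividedStar, Equivalent033 (bistar S T) (bistar S' T)

/-- Reduction of the path lengths modulo 3: paths of length `0` modulo 3 disappear. -/
def reduce : SubdividedStar → SubdividedStar
  | empty => empty
  | star arms => star (arms.filterMap fun l =>
      if h : 0 < (l : ℕ) % 3 then some ⟨(l : ℕ) % 3, h⟩ else none)

/-- The number of paths of length exactly 2 of a star. -/
def twos : SubdividedStar → ℕ
  | empty => 0
  | star arms => arms.count 2

end SubdividedStar

/-! ### The eight classes -/

/-- Names of the eight classes `𝒞₀, 𝒞₁, 𝒞₁*, 𝒞₂, 𝒞₂*, 𝒞₂□, 𝒞₃, 𝒞₃□`. -/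
inductive StarClass : Type
  | c0 | c1 | c1s | c2 | c2s | c2b | c3 | c3b

namespace StarClass

/-- `𝒞₁* = {P₁, S_{2,1}, S_{2,2,2}}` (after reduction of the paths modulo 3). -/
def set1s : Set SubdividedStar :=
  {S | S.reduce ∈ ({.star 0, .star {2, 1}, .star {2, 2, 2}} : Set SubdividedStar)}

/-- `𝒞₂* = {P₂, S_{2,2}}` (after reduction of the paths modulo 3). -/
def set2s : Set SubdividedStar :=
  {S | S.reduce ∈ ({.star {1}, .star {2, 2}} : Set SubdividedStar)}

/-- Stars with Grundy value `i` and, after reduction modulo 3, one or three paths of length 2. -/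
def setBox (i : ℕ) : Set SubdividedStar :=
  {S | S.grundy = i ∧ (S.reduce.twos = 1 ∨ S.reduce.twos = 3)}

/-- Stars with Grundy value `i` lying in none of `𝒞₁*`, `𝒞₂*`, `𝒞₂□`, `𝒞₃□`. -/
def setPlain (i : ℕ) : Set SubdividedStar :=
  {S | S.grundy = i ∧ S ∉ set1s ∧ S ∉ set2s ∧ S ∉ setBox 2 ∧ S ∉ setBox 3}

/-- The set of subdivided stars with the given class name. -/
def toSet : StarClass → Set SubdividedStar
  | c0 => setPlain 0
  | c1 => setPlain 1
  | c1s => set1s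
  | c2 => setPlain 2
  | c2s => set2s
  | c2b => setBox 2
  | c3 => setPlain 3
  | c3b => setBox 3

/-- The table of Grundy values of `S–S'`; `none` stands for the entry `⊕` (nim-sum). -/
def table : StarClass → StarClass → Option ℕ
  | c1s, c1s => some 2
  | c1s, c2s => some 0
  | c2s, c1s => some 0
  | c2s, c2s => some 1
  | c2s, c2b => some 1
  | c2b, c2s => some 1
  | c2s, c3b => some 0
  | c3b, c2s => some 0
  | _, _ => none

end StarClass

/-! A move in a bistar shortens a leg by one or two vertices, clears one side, or leaves a subset
of a single path. So, after embedding the bistar in a fixed infinite graph, a position is a pair of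
sides, each of them empty or a star, as long as it is not a set of vertices of a single leg. On a
path the Grundy value is the number of vertices modulo 3.

The class of a star turns out to depend only on the numbers `a` and `b` of its paths of length 1
and 2 modulo 3, and these numbers matter only up to parity once `a ≥ 2` and `b ≥ 4`. This makes the
table of the classes a finite object, and the mex rule can be checked on it: a move never keeps the
value of the pair of classes, and every smaller value is reached from one of the two sides. The
classes are distinguished by the rows of the table of values, hence they are the classes of `∼₁`.
-/

namespace ImpartialGame

variable {P Q X : Type} (g : ImpartialGame P) (h : ImpartialGame Q)

theorem exists_forall_opt_grundy_ne (J : P) : ∃ n, ∀ J', g.Opt J J' → g.grundy J' ≠ n := by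
  obtain ⟨n, hn⟩ := ((g.finite_opt J).image g.grundy).exists_notMem
  exact ⟨n, fun J' hJ' he => hn ⟨J', hJ', he⟩⟩

variable {g h} {J J' : P}

theorem grundy_ne_of_opt (hJ' : g.Opt J J') : g.grundy J' ≠ g.grundy J := by
  rw [g.grundy_eq J]
  exact Nat.sInf_mem (g.exists_forall_opt_grundy_ne J) J' hJ'

theorem exists_opt_grundy_eq {m : ℕ} (hm : m < g.grundy J) :
    ∃ J', g.Opt J J' ∧ g.grundy J' = m := by
  rw [g.grundy_eq J] at hm
  simpa using Nat.notMem_of_lt_sInf hm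

theorem grundy_eq_of_mex {n : ℕ} (hne : ∀ J', g.Opt J J' → g.grundy J' ≠ n)
    (hlt : ∀ m < n, ∃ J', g.Opt J J' ∧ g.grundy J' = m) : g.grundy J = n := by
  refine le_antisymm ?_ ?_
  · rw [g.grundy_eq J]
    exact Nat.sInf_le hne
  · by_contra! h
    obtain ⟨J', hJ', he⟩ := hlt _ h
    exact grundy_ne_of_opt hJ' he

/-- A family of positions is allowed to leave the family as long as the options outside it have
the wrong Grundy value. -/
theorem grundy_eq_of_family (p : X → P) (v : X → ℕ)
    (hne : ∀ x J', g.Opt (p x) J' → (∃ x', p x' = J' ∧ v x' ≠ v x) ∨ g.grundy J' ≠ v x)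
    (hlt : ∀ x, ∀ m < v x, ∃ x', g.Opt (p x) (p x') ∧ v x' = m) (x : X) :
    g.grundy (p x) = v x := by
  induction x using (InvImage.wf p g.wf).induction with
  | _ x ih =>
  refine grundy_eq_of_mex (fun J' hJ' => ?_) fun m hm => ?_
  · rcases hne x J' hJ' with ⟨x', rfl, hx'⟩ | hJ'
    · rwa [ih x' hJ']
    · exact hJ'
  · obtain ⟨x', hx', rfl⟩ := hlt x m hm
    exact ⟨_, hx', ih x' hx'⟩

theorem isPPosition_iff_of_forall {W : P → Prop}
    (hW : ∀ J, W J ↔ ∀ J', g.Opt J J' → ¬ W J') (J : P) : g.IsPPosition J ↔ W J := by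
  induction J using g.wf.induction with
  | _ J ih =>
  rw [g.isPPosition_iff, hW]
  exact forall₂_congr fun J' hJ' => not_congr (ih J' hJ')

theorem grundy_eq_iff_forall_sum_opt (p : P × Q) :
    g.grundy p.1 = h.grundy p.2 ↔
      ∀ q, (g.sum h).Opt p q → ¬ g.grundy q.1 = h.grundy q.2 := by
  obtain ⟨J, K⟩ := p
  constructor
  · rintro he ⟨J', K'⟩ (⟨hJ, rfl : K' = K⟩ | ⟨rfl : J' = J, hK⟩) he'
    · exact grundy_ne_of_opt hJ (he'.trans he.symm)
    · exact grundy_ne_of_opt hK (he'.symm.trans he)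
  · intro hne
    rcases lt_trichotomy (g.grundy J) (h.grundy K) with hlt | heq | hlt
    · obtain ⟨K', hK, he⟩ := exists_opt_grundy_eq hlt
      exact absurd he.symm (hne (J, K') (.inr ⟨rfl, hK⟩))
    · exact heq
    · obtain ⟨J', hJ, he⟩ := exists_opt_grundy_eq hlt
      exact absurd he (hne (J', K) (.inl ⟨hJ, rfl⟩))

theorem equivalent_iff_grundy_eq {K : Q} :
    g.Equivalent J h K ↔ g.grundy J = h.grundy K :=
  isPPosition_iff_of_forall grundy_eq_iff_forall_sum_opt (J, K)

end ImpartialGame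

section Connectivity

open SimpleGraph

variable {V : Type} {G : SimpleGraph V} {s : Set V}

theorem induce_preconnected_iff_forall_cut :
    (G.induce s).Preconnected ↔
      ∀ p : V → Prop, (∀ x ∈ s, ∀ y ∈ s, G.Adj x y → p x → p y) →
        ∀ x ∈ s, ∀ y ∈ s, p x → p y := by
  constructor
  · intro hs p hp x hx y hy hpx
    have hwalk : ∀ {u v : s}, (G.induce s).Walk u v → p u → p v := by
      intro u v w
      induction w with
      | nil => exact id
      | cons hadj _ ih => exact fun hu => ih (hp _ (Subtype.prop _) _ (Subtype.prop _) hadj hu)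
    obtain ⟨w⟩ := hs ⟨x, hx⟩ ⟨y, hy⟩
    exact hwalk w hpx
  · rintro hcut ⟨x, hx⟩ ⟨y, hy⟩
    obtain ⟨_, hr⟩ := hcut (fun v => ∃ hv : v ∈ s, (G.induce s).Reachable ⟨x, hx⟩ ⟨v, hv⟩)
      (fun u _ v hv huv ⟨_, hr⟩ =>
        ⟨hv, hr.trans (Adj.reachable (G := G.induce s) (u := ⟨u, _⟩) (v := ⟨v, hv⟩) huv)⟩)
      x hx y hy ⟨hx, .rfl⟩
    exact hr

end Connectivity

section OctalEmbedding

open SimpleGraph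

variable {V W : Type} {G : SimpleGraph V} {H : SimpleGraph W} (φ : G ↪g H)

/-- The isomorphism between an induced subgraph and its image under a graph embedding. -/
noncomputable def induceImageIso (s : Set V) : G.induce s ≃g H.induce (φ '' s) where
  toEquiv := Equiv.Set.image φ s φ.injective
  map_rel_iff' := by simp

variable {A X : Finset V}

theorem componentOf_map : componentOf H (A.map φ.toEmbedding) (X.map φ.toEmbedding) =
    φ '' componentOf G A X := by
  have hreach : ∀ {x v : V} (hx : x ∈ (A : Set V)) (hv : v ∈ (A : Set V))
      (hx' : φ x ∈ φ '' (A : Set V)) (hv' : φ v ∈ φ '' (A : Set V)),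
      (H.induce (φ '' (A : Set V))).Reachable ⟨φ x, hx'⟩ ⟨φ v, hv'⟩ ↔
        (G.induce (A : Set V)).Reachable ⟨x, hx⟩ ⟨v, hv⟩ :=
    fun hx hv _ _ => (induceImageIso φ (A : Set V)).reachable_iff (u := ⟨_, hx⟩) (v := ⟨_, hv⟩)
  have hA : ((A.map φ.toEmbedding : Finset W) : Set W) = φ '' (A : Set V) := Finset.coe_map ..
  rw [componentOf, hA]
  ext w
  constructor
  · rintro ⟨x, hxX, hx, hv, hr⟩
    obtain ⟨x, hxA, rfl⟩ := hx
    obtain ⟨v, hvA, rfl⟩ := hv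
    exact ⟨v, ⟨x, (Finset.mem_map' _).1 hxX, hxA, hvA, (hreach hxA hvA _ _).1 hr⟩, rfl⟩
  · rintro ⟨v, ⟨x, hxX, hxA, hvA, hr⟩, rfl⟩
    exact ⟨φ x, Finset.mem_map_of_mem _ hxX, ⟨x, hxA, rfl⟩, ⟨v, hvA, rfl⟩,
      (hreach hxA hvA _ _).2 hr⟩

theorem octalLegal_map_iff {u : ℕ → Fin 8} :
    OctalLegal u H (A.map φ.toEmbedding) (X.map φ.toEmbedding) ↔ OctalLegal u G A X := by
  have hrest : componentOf H (A.map φ.toEmbedding) (X.map φ.toEmbedding) \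
      (X.map φ.toEmbedding : Finset W) = φ '' (componentOf G A X \ X) := by
    rw [componentOf_map, Finset.coe_map, Set.image_sdiff φ.injective]
    rfl
  have hX : ((X.map φ.toEmbedding : Finset W) : Set W) = φ '' (X : Set V) := Finset.coe_map ..
  rw [OctalLegal, OctalLegal, hrest, hX, Finset.map_subset_map, Finset.card_map,
    Set.image_eq_empty, Set.image_nonempty, (induceImageIso φ _).connected_iff,
    (induceImageIso φ _).connected_iff]

variable [DecidableEq V] [DecidableEq W]

theorem octalGame_opt_map_iff {u : ℕ → Fin 8} {B : Finset W} :
    (octalGame u H).Opt (A.map φ.toEmbedding) B ↔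
      ∃ A', (octalGame u G).Opt A A' ∧ A'.map φ.toEmbedding = B := by
  constructor
  · rintro ⟨Y, hY, rfl⟩
    obtain ⟨X, -, rfl⟩ := Finset.subset_map_iff.1 hY.1
    exact ⟨A \ X, ⟨X, (octalLegal_map_iff φ).1 hY, rfl⟩, Finset.map_sdiff ..⟩
  · rintro ⟨_, ⟨X, hX, rfl⟩, rfl⟩
    exact ⟨X.map φ.toEmbedding, (octalLegal_map_iff φ).2 hX, Finset.map_sdiff ..⟩

theorem grundy_octalGame_map (u : ℕ → Fin 8) (A : Finset V) :
    (octalGame u H).grundy (A.map φ.toEmbedding) = (octalGame u G).grundy A := by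
  refine ImpartialGame.grundy_eq_of_family _ _ (fun A B hB => .inl ?_) (fun A m hm => ?_) A
  · obtain ⟨A', hA', rfl⟩ := (octalGame_opt_map_iff φ).1 hB
    exact ⟨A', rfl, ImpartialGame.grundy_ne_of_opt hA'⟩
  · obtain ⟨A', hA', he⟩ := ImpartialGame.exists_opt_grundy_eq hm
    exact ⟨A', (octalGame_opt_map_iff φ).2 ⟨A', hA', rfl⟩, he⟩

end OctalEmbedding

section ConnectedPosition

open SimpleGraph

variable {V : Type} {G : SimpleGraph V} {A B X : Finset V}

theorem componentOf_eq_of_preconnected (hA : (G.induce (A : Set V)).Preconnected)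
    (hXA : X ⊆ A) (hX : X.Nonempty) : componentOf G A X = A := by
  obtain ⟨x, hx⟩ := hX
  ext v
  exact ⟨fun ⟨_, _, _, hv, _⟩ => hv, fun hv => ⟨x, hx, hXA hx, hv, hA _ _⟩⟩

variable [DecidableEq V]

/-- `B` arises from `A` by removing a vertex or the two ends of an edge. Allowing `x = y` treats
the two kinds of removal uniformly. -/
def RemovesVertexOrEdge (G : SimpleGraph V) (A B : Finset V) : Prop :=
  ∃ x ∈ A, ∃ y ∈ A, (x = y ∨ G.Adj x y) ∧ B = A \ {x, y}

theorem RemovesVertexOrEdge.subset (h : RemovesVertexOrEdge G A B) : B ⊆ A := by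
  obtain ⟨x, _, y, _, _, rfl⟩ := h
  exact Finset.sdiff_subset

theorem RemovesVertexOrEdge.card_eq (h : RemovesVertexOrEdge G A B) :
    A.card = B.card + 1 ∨ A.card = B.card + 2 := by
  obtain ⟨x, hx, y, hy, hxy, rfl⟩ := h
  have hcard := Finset.card_sdiff_add_card_eq_card
    (Finset.insert_subset hx (Finset.singleton_subset_iff.2 hy))
  rw [← hcard]
  rcases hxy with rfl | hxy
  · simp
  · simp [Finset.card_pair hxy.ne]

theorem octalLegal_code033_iff (hA : (G.induce (A : Set V)).Preconnected) :
    OctalLegal code033 G A X ↔ X ⊆ A ∧ (G.induce (X : Set V)).Connected ∧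
      (X.card = 1 ∨ X.card = 2) ∧ (G.induce ((A \ X : Finset V) : Set V)).Preconnected := by
  have hbit0 : (code033 X.card).val.testBit 0 = true ↔ X.card = 1 ∨ X.card = 2 := by
    unfold code033; split_ifs with h <;> simp [h]
  have hbit1 : (code033 X.card).val.testBit 1 = true ↔ X.card = 1 ∨ X.card = 2 := by
    unfold code033; split_ifs with h <;> simp [h, Nat.testBit]
  have hbit2 : (code033 X.card).val.testBit 2 = false := by
    unfold code033; split_ifs with h <;> decide
  rw [OctalLegal, hbit0, hbit1]
  refine and_congr_right fun hXA => and_congr_right fun hX => ?_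
  have hne : X.Nonempty := Set.nonempty_coe_sort.1 hX.nonempty
  rw [componentOf_eq_of_preconnected hA hXA hne, ← Finset.coe_sdiff, Finset.coe_eq_empty,
    Finset.coe_nonempty, connected_iff]
  rcases (A \ X).eq_empty_or_nonempty with hrest | hrest
  · have : Subsingleton ((A \ X : Finset V) : Set V) :=
      Set.Subsingleton.coe_sort (by simp [hrest])
    have hpre : (G.induce ((A \ X : Finset V) : Set V)).Preconnected :=
      .of_subsingleton
    rw [hrest] at hpre ⊢
    simp [hpre]
  · have hnon : Nonempty ((A \ X : Finset V) : Set V) := hrest.to_subtype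
    simp only [hrest.ne_empty, hnon, hbit2, Bool.false_eq_true, false_and, true_and,
      false_or, or_false, and_comm]

theorem octalGame_code033_opt_iff (hA : (G.induce (A : Set V)).Preconnected) :
    (octalGame code033 G).Opt A B ↔
      RemovesVertexOrEdge G A B ∧ (G.induce (B : Set V)).Preconnected := by
  change (∃ X, OctalLegal code033 G A X ∧ B = A \ X) ↔ _
  constructor
  · rintro ⟨X, hX, rfl⟩
    obtain ⟨hXA, hX, hcard, hB⟩ := (octalLegal_code033_iff hA).1 hX
    refine ⟨?_, hB⟩
    rcases hcard with hcard | hcard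
    · obtain ⟨x, rfl⟩ := Finset.card_eq_one.1 hcard
      have hx : x ∈ A := hXA (Finset.mem_singleton_self x)
      exact ⟨x, hx, x, hx, .inl rfl, by simp⟩
    · obtain ⟨x, y, hxy, rfl⟩ := Finset.card_eq_two.1 hcard
      obtain ⟨hx, hy⟩ := by simpa [Finset.insert_subset_iff] using hXA
      refine ⟨x, hx, y, hy, .inr ?_, rfl⟩
      have hcut := induce_preconnected_iff_forall_cut.1 hX.preconnected
      by_contra hadj
      have := hcut (· = x) (by simp; grind [G.adj_comm]) x (by simp) y (by simp) rfl
      exact hxy this.symm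
  · rintro ⟨⟨x, hx, y, hy, hxy, rfl⟩, hB⟩
    refine ⟨{x, y}, (octalLegal_code033_iff hA).2 ⟨?_, ?_, ?_, hB⟩, rfl⟩
    · exact Finset.insert_subset hx (Finset.singleton_subset_iff.2 hy)
    · rcases hxy with rfl | hxy
      · rw [Finset.pair_eq_singleton, Finset.coe_singleton, induce_singleton_eq_top]
        exact connected_top
      · rw [Finset.coe_pair]
        exact induce_pair_connected_of_adj hxy
    · rcases hxy with rfl | hxy
      · simp
      · simp [Finset.card_pair hxy.ne]

end ConnectedPosition

section Path

open SimpleGraph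

theorem induce_hasse_nat_preconnected_iff {s : Set ℕ} :
    ((hasse ℕ).induce s).Preconnected ↔ s.OrdConnected := by
  rw [induce_preconnected_iff_forall_cut, Set.ordConnected_iff]
  constructor
  · rintro hcut x hx y hy - z ⟨hxz, hzy⟩
    by_contra hz
    have hlt : y < z := hcut (· < z)
      (fun u _ v hv huv hu => by
        have hne : v ≠ z := fun h => hz (h ▸ hv)
        simp only [hasse_adj, Nat.covBy_iff_add_one_eq] at huv
        omega)
      x hx y hy (lt_of_le_of_ne hxz fun h => hz (h ▸ hx))
    omega
  · intro hord p hp x hx y hy hpx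
    have hmem : ∀ {a b c}, a ∈ s → b ∈ s → a ≤ c → c ≤ b → c ∈ s :=
      fun {a b c} ha hb hac hcb => hord a ha b hb (hac.trans hcb) ⟨hac, hcb⟩
    rcases le_total x y with hxy | hyx
    · induction y, hxy using Nat.le_induction with
      | base => exact hpx
      | succ z hz ih =>
        have hzs := hmem hx hy hz z.le_succ
        exact hp z hzs _ hy (by simp) (ih hzs)
    · induction x, hyx using Nat.le_induction with
      | base => exact hpx
      | succ z hz ih =>
        have hzs := hmem hy hx hz z.le_succ
        exact ih hzs (hp _ hx z hzs (by simp) hpx)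

theorem exists_eq_Ico_of_induce_hasse_preconnected {B : Finset ℕ}
    (hB : ((hasse ℕ).induce (B : Set ℕ)).Preconnected) : ∃ a n, B = Finset.Ico a (a + n) := by
  rw [induce_hasse_nat_preconnected_iff] at hB
  rcases B.eq_empty_or_nonempty with rfl | hne
  · exact ⟨0, 0, by simp⟩
  · refine ⟨B.min' hne, B.max' hne + 1 - B.min' hne, ?_⟩
    have hle := B.min'_le_max' hne
    ext j
    rw [Finset.mem_Ico]
    constructor
    · intro hj
      have := B.min'_le j hj
      have := B.le_max' j hj
      omega
    · intro hj
      exact hB.out (B.min'_mem hne) (B.max'_mem hne) ⟨hj.1, by omega⟩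

theorem removesVertexOrEdge_Ico {a n d : ℕ} (hd : d = 1 ∨ d = 2) (hdn : d ≤ n) :
    RemovesVertexOrEdge (hasse ℕ) (Finset.Ico a (a + n)) (Finset.Ico a (a + (n - d))) := by
  refine ⟨a + n - 1, by simp; omega, a + n - d, by simp; omega, ?_, ?_⟩
  · simp only [hasse_adj, Nat.covBy_iff_add_one_eq]
    omega
  · ext j
    simp only [Finset.mem_Ico, Finset.mem_sdiff, Finset.mem_insert, Finset.mem_singleton]
    omega

theorem grundy_code033_of_induce_hasse_preconnected {B : Finset ℕ}
    (hB : ((hasse ℕ).induce (B : Set ℕ)).Preconnected) :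
    (octalGame code033 (hasse ℕ)).grundy B = B.card % 3 := by
  have hIco : ∀ a n,
      ((hasse ℕ).induce ((Finset.Ico a (a + n) : Finset ℕ) : Set ℕ)).Preconnected := by
    intro a n
    rw [induce_hasse_nat_preconnected_iff, Finset.coe_Ico]
    exact Set.ordConnected_Ico
  obtain ⟨a, n, rfl⟩ := exists_eq_Ico_of_induce_hasse_preconnected hB
  rw [Nat.card_Ico, Nat.add_sub_cancel_left]
  refine ImpartialGame.grundy_eq_of_family (fun q : ℕ × ℕ => Finset.Ico q.1 (q.1 + q.2))
    (fun q => q.2 % 3) ?_ ?_ (a, n)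
  · rintro ⟨a, n⟩ B hB
    obtain ⟨hrem, hpre⟩ := (octalGame_code033_opt_iff (hIco a n)).1 hB
    obtain ⟨a', n', rfl⟩ := exists_eq_Ico_of_induce_hasse_preconnected hpre
    have hcard := hrem.card_eq
    simp only [Nat.card_Ico, Nat.add_sub_cancel_left] at hcard
    exact .inl ⟨(a', n'), rfl, by dsimp only; omega⟩
  · rintro ⟨a, n⟩ m (hm : m < n % 3)
    refine ⟨(a, n - (n % 3 - m)), (octalGame_code033_opt_iff (hIco a n)).2
      ⟨removesVertexOrEdge_Ico (by omega) (by omega), hIco _ _⟩, ?_⟩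
    dsimp only
    omega

end Path

namespace StarClass

instance : DecidableEq StarClass := fun c c' => by
  cases c <;> cases c' <;> first | exact isTrue rfl | exact isFalse (by nofun)

instance : Fintype StarClass where
  elems := {c0, c1, c1s, c2, c2s, c2b, c3, c3b}
  complete := by intro c; cases c <;> decide

/-- The Grundy value of the stars of a class. -/
def value : StarClass → ℕ
  | c0 => 0
  | c1 | c1s => 1
  | c2 | c2s | c2b => 2
  | c3 | c3b => 3

/-- The Grundy value of a bistar whose two stars lie in the given classes. -/
def pairValue (c c' : StarClass) : ℕ := (table c c').getD (c.value ^^^ c'.value)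

theorem pairValue_comm (c c' : StarClass) : pairValue c c' = pairValue c' c := by
  revert c c'; decide

theorem pairValue_c0 (c : StarClass) : pairValue c c0 = c.value := by
  revert c; decide

theorem pairValue_left_injective : Function.Injective pairValue := by
  suffices ∀ c c', (∀ d, pairValue c d = pairValue c' d) → c = c' from
    fun c c' h => this c c' (congrFun h)
  decide

/-- Exchanging a star of the class `c` for a star of the class `c'` always changes the Grundy
value of a bistar, so that a move between such stars respects the mex rule. -/
def Separated (c c' : StarClass) : Prop := ∀ d, pairValue c d ≠ pairValue c' d

instance : DecidableRel Separated := fun c c' =>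
  inferInstanceAs (Decidable (∀ d, pairValue c d ≠ pairValue c' d))

theorem Separated.symm {c c' : StarClass} (h : Separated c c') : Separated c' c :=
  fun d => (h d).symm

/-- The successor on `Fin (k + 2)`, except that the last element `k + 1` is followed by `k`. -/
def capSucc {k : ℕ} (x : Fin (k + 2)) : Fin (k + 2) :=
  if h : x.val + 1 < k + 2 then ⟨x.val + 1, h⟩ else ⟨k, by omega⟩

/-- The image of a natural number in the quotient of `ℕ` in which, from `k` on, only the parity
matters. -/
def cap (k : ℕ) : ℕ → Fin (k + 2)
  | 0 => 0
  | n + 1 => capSucc (cap k n)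

theorem val_cap (k n : ℕ) : (cap k n).val = if n < k then n else k + (n - k) % 2 := by
  induction n with
  | zero => rcases k with _ | k <;> simp [cap]
  | succ n ih =>
    rw [cap, capSucc]
    split_ifs at ih ⊢ <;> dsimp only <;> omega

theorem cap_eq_iff {k n : ℕ} {i : Fin (k + 2)} (hi : i.val < k) : cap k n = i ↔ n = i.val := by
  rw [Fin.ext_iff, val_cap]
  split_ifs <;> omega

/-- The class of a star in terms of the numbers of its paths of length 1 modulo 3 (the row) and of
length 2 modulo 3 (the column), which are capped at 2 and at 4 respectively. -/
def ofCap (x : Fin 4) (y : Fin 6) : StarClass :=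
  ![![c1s, c0, c2s, c1s, c0, c2],
    ![c2s, c1s, c0, c2b, c1, c3],
    ![c0, c2b, c1, c3b, c0, c2],
    ![c1, c3b, c0, c2b, c1, c3]] x y

/-- The class of a star with `a` paths of length 1 modulo 3 and `b` paths of length 2 modulo 3. -/
def ofCounts (a b : ℕ) : StarClass := ofCap (cap 2 a) (cap 4 b)

theorem separated_ofCounts_succ_left (a b : ℕ) :
    Separated (ofCounts (a + 1) b) (ofCounts a b) := by
  rw [ofCounts, ofCounts, cap]
  generalize cap 2 a = x, cap 4 b = y
  revert x y
  decide

theorem separated_ofCounts_succ_right (a b : ℕ) :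
    Separated (ofCounts a (b + 1)) (ofCounts a b) := by
  rw [ofCounts, ofCounts, cap]
  generalize cap 2 a = x, cap 4 b = y
  revert x y
  decide

theorem separated_ofCounts_succ_succ (a b : ℕ) :
    Separated (ofCounts a (b + 1)) (ofCounts (a + 1) b) := by
  rw [ofCounts, ofCounts, cap, cap]
  generalize cap 2 a = x, cap 4 b = y
  revert x y
  decide

theorem value_ofCounts_of_le {a b : ℕ} (ha : a ≤ 2) (hb : b ≤ 1) :
    (ofCounts a b).value = (1 + a + 2 * b) % 3 := by
  interval_cases a <;> interval_cases b <;> rfl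

theorem pairValue_ofCounts_of_le_one {a b a' b' : ℕ} (ha : a ≤ 1) (hb : b ≤ 1) (ha' : a' ≤ 1)
    (hb' : b' ≤ 1) :
    pairValue (ofCounts a b) (ofCounts a' b') = (2 + a + 2 * b + a' + 2 * b') % 3 := by
  interval_cases a <;> interval_cases b <;> interval_cases a' <;> interval_cases b' <;> rfl

/-- Each entry lists classes one of which is reached by a move from every star of the given class
other than `P₁`. Only for the class `𝒞₂□` does the class reached depend on the star. -/
def forcedOptions : StarClass → List (List StarClass)
  | c0 => []
  | c1 => [[c0]]
  | c1s => [[c0], [c2s]]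
  | c2 => [[c0], [c1]]
  | c2s => [[c0], [c1s]]
  | c2b => [[c0], [c1], [c1s, c3b]]
  | c3 => [[c0], [c1], [c2]]
  | c3b => [[c0], [c1], [c2b]]

theorem exists_forcedOptions_of_lt : ∀ c c' : StarClass, ∀ n < pairValue c c',
    (∃ l ∈ forcedOptions c, ∀ d ∈ l, pairValue d c' = n) ∨
      ∃ l ∈ forcedOptions c', ∀ d ∈ l, pairValue c d = n := by
  intro c
  cases c <;> decide

theorem exists_forcedOptions_of_lt_c1s : ∀ c : StarClass, ∀ n < pairValue c c1s,
    pairValue c c0 = n ∨ ∃ l ∈ forcedOptions c, ∀ d ∈ l, pairValue d c1s = n := by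
  decide

theorem ofCounts_mem_of_mem_forcedOptions_succ_zero (a : ℕ) :
    ∀ l ∈ forcedOptions (ofCounts (a + 2) 0), ofCounts (a + 1) 0 ∈ l := by
  simp only [ofCounts, cap]
  generalize cap 2 a = x
  revert x
  decide

theorem ofCounts_mem_of_mem_forcedOptions_zero_succ (b : ℕ) :
    ∀ l ∈ forcedOptions (ofCounts 0 (b + 1)), ofCounts 0 b ∈ l ∨ ofCounts 1 b ∈ l := by
  simp only [ofCounts, cap]
  generalize cap 4 b = y
  revert y
  decide

theorem ofCounts_mem_of_mem_forcedOptions_succ_succ (a b : ℕ) :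
    ∀ l ∈ forcedOptions (ofCounts (a + 1) (b + 1)),
      ofCounts a (b + 1) ∈ l ∨ ofCounts (a + 1) b ∈ l ∨ ofCounts (a + 2) b ∈ l := by
  simp only [ofCounts, cap]
  generalize cap 2 a = x, cap 4 b = y
  revert x y
  decide

end StarClass

/-- The part of a position lying on one side of a bistar whose legs are indexed by `ι`: nothing, or
the centre together with the first `f i` vertices of the leg `i`, for every `i`. Legs of length `0`
are allowed, so that `star 0` is the star `P₁`. -/
inductive Side (ι : Type) : Type
  | empty : Side ι
  | star (f : ι → ℕ) : Side ι

section ResidueCount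

variable {ι : Type} [Fintype ι]

/-- The number of entries of `f` which are congruent to `r < 3` modulo 3. -/
def residueCount (r : ℕ) (f : ι → ℕ) : ℕ := (Finset.univ.filter fun i => f i % 3 = r).card

theorem residueCount_eq_sum (r : ℕ) (f : ι → ℕ) :
    residueCount r f = ∑ i, if f i % 3 = r then 1 else 0 :=
  Finset.card_filter _ _

theorem sum_eq_residueCount (f : ι → ℕ) :
    ∑ i, f i = residueCount 1 f + 2 * residueCount 2 f + 3 * ∑ i, f i / 3 := by
  rw [residueCount_eq_sum, residueCount_eq_sum, Finset.mul_sum, Finset.mul_sum,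
    ← Finset.sum_add_distrib, ← Finset.sum_add_distrib]
  refine Finset.sum_congr rfl fun i _ => ?_
  split_ifs <;> omega

theorem mod_three_ne_of_residueCount_eq_zero {r : ℕ} {f : ι → ℕ} (h : residueCount r f = 0)
    (i : ι) : f i % 3 ≠ r :=
  Finset.filter_eq_empty_iff.1 (Finset.card_eq_zero.1 h) (Finset.mem_univ i)

theorem exists_mod_three_eq_of_residueCount_eq_succ {r n : ℕ} {f : ι → ℕ}
    (h : residueCount r f = n + 1) : ∃ i, f i % 3 = r := by
  obtain ⟨i, hi⟩ := Finset.card_pos.1 (show 0 < residueCount r f by omega)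
  exact ⟨i, (Finset.mem_filter.1 hi).2⟩

variable [DecidableEq ι]

theorem residueCount_update (r : ℕ) (f : ι → ℕ) (i : ι) (v : ℕ) :
    residueCount r (Function.update f i v) + (if f i % 3 = r then 1 else 0) =
      residueCount r f + if v % 3 = r then 1 else 0 := by
  have hrest : ∑ j ∈ Finset.univ.erase i, (if Function.update f i v j % 3 = r then 1 else 0) =
      ∑ j ∈ Finset.univ.erase i, if f j % 3 = r then 1 else 0 :=
    Finset.sum_congr rfl fun j hj => by rw [Function.update_of_ne (Finset.ne_of_mem_erase hj)]
  rw [residueCount_eq_sum, residueCount_eq_sum, ← Finset.add_sum_erase _ _ (Finset.mem_univ i),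
    hrest, ← Finset.add_sum_erase _ (fun j => if f j % 3 = r then 1 else 0) (Finset.mem_univ i),
    Function.update_self]
  omega

theorem residueCount_le_of_sum_update_zero_le {f : ι → ℕ} {i : ι} {n : ℕ}
    (h : ∑ k, Function.update f i 0 k ≤ n) :
    residueCount 1 f ≤ n + 1 ∧ residueCount 2 f ≤ n / 2 + 1 := by
  have hsum := sum_eq_residueCount (Function.update f i 0)
  have h1 := residueCount_update 1 f i 0
  have h2 := residueCount_update 2 f i 0
  split_ifs at h1 h2 <;> omega

end ResidueCount

namespace Side

open StarClass

variable {ι κ : Type} [Fintype ι] [Fintype κ]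

/-- The class of the star on a side. -/
def starClass : Side ι → StarClass
  | empty => c0
  | star f => ofCounts (residueCount 1 f) (residueCount 2 f)

theorem starClass_star_zero : (star 0 : Side ι).starClass = c1s := by
  have h : ∀ r ∈ [1, 2], residueCount r (0 : ι → ℕ) = 0 := by simp [residueCount]
  rw [starClass, h 1 (by simp), h 2 (by simp)]
  rfl

variable [DecidableEq ι] [DecidableEq κ]

/-- The moves that touch one side and either leave its centre in place or clear the side. -/
inductive Move : Side ι → Side ι → Prop
  | shorten (f : ι → ℕ) (i : ι) (d : ℕ) (hd : d = 1 ∨ d = 2) (hdi : d ≤ f i) :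
      Move (star f) (star (Function.update f i (f i - d)))
  | clear (f : ι → ℕ) (hf : ∑ i, f i ≤ 1) : Move (star f) empty

theorem Move.separated {x y : Side ι} (h : Move x y) : Separated x.starClass y.starClass := by
  rcases h with ⟨f, i, d, hd, hdi⟩ | ⟨f, hf⟩
  · have h1 := residueCount_update 1 f i (f i - d)
    have h2 := residueCount_update 2 f i (f i - d)
    rw [starClass, starClass]
    generalize residueCount 1 f = a, residueCount 2 f = b,
      residueCount 1 (Function.update f i (f i - d)) = a',
      residueCount 2 (Function.update f i (f i - d)) = b' at h1 h2 ⊢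
    obtain ⟨rfl, rfl⟩ | ⟨rfl, rfl⟩ | ⟨rfl, rfl⟩ | ⟨rfl, rfl⟩ | ⟨rfl, rfl⟩ | ⟨rfl, rfl⟩ :
        (a = a' + 1 ∧ b = b') ∨ (a' = a + 1 ∧ b = b') ∨ (b = b' + 1 ∧ a = a') ∨
        (b' = b + 1 ∧ a = a') ∨ (b = b' + 1 ∧ a' = a + 1) ∨ (b' = b + 1 ∧ a = a' + 1) := by
      split_ifs at h1 h2 <;> omega
    · exact separated_ofCounts_succ_left _ _
    · exact (separated_ofCounts_succ_left _ _).symm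
    · exact separated_ofCounts_succ_right _ _
    · exact (separated_ofCounts_succ_right _ _).symm
    · exact separated_ofCounts_succ_succ _ _
    · exact (separated_ofCounts_succ_succ _ _).symm
  · have hsum := sum_eq_residueCount f
    have h1 : residueCount 1 f ≤ 1 := by omega
    have h2 : residueCount 2 f = 0 := by omega
    rw [starClass, starClass, h2]
    generalize residueCount 1 f = a at h1
    interval_cases a <;> decide

/-- A move leads from the given side to a side of the class `c`. -/
def HasOption (x : Side ι) (c : StarClass) : Prop := ∃ y, Move x y ∧ y.starClass = c

variable {f : ι → ℕ} {a b : ℕ}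

theorem hasOption_of_shorten {d : ℕ} (i : ι) (hd : d = 1 ∨ d = 2) (hdi : d ≤ f i)
    (ha : residueCount 1 f + (if (f i - d) % 3 = 1 then 1 else 0) =
      a + if f i % 3 = 1 then 1 else 0)
    (hb : residueCount 2 f + (if (f i - d) % 3 = 2 then 1 else 0) =
      b + if f i % 3 = 2 then 1 else 0) :
    HasOption (star f) (ofCounts a b) := by
  refine ⟨_, .shorten f i d hd hdi, ?_⟩
  rw [starClass, Nat.add_right_cancel ((residueCount_update 1 f i _).trans ha),
    Nat.add_right_cancel ((residueCount_update 2 f i _).trans hb)]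

theorem hasOption_of_residueCount_one (h1 : residueCount 1 f = a + 1)
    (h2 : residueCount 2 f = b) : HasOption (star f) (ofCounts a b) := by
  obtain ⟨i, hi⟩ := exists_mod_three_eq_of_residueCount_eq_succ h1
  exact hasOption_of_shorten i (.inl rfl) (by omega) (by split_ifs <;> omega)
    (by split_ifs <;> omega)

theorem hasOption_of_residueCount_two (h1 : residueCount 1 f = a)
    (h2 : residueCount 2 f = b + 1) : HasOption (star f) (ofCounts a b) := by
  obtain ⟨i, hi⟩ := exists_mod_three_eq_of_residueCount_eq_succ h2
  exact hasOption_of_shorten i (.inr rfl) (by omega) (by split_ifs <;> omega)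
    (by split_ifs <;> omega)

theorem hasOption_succ_of_residueCount_two (h1 : residueCount 1 f = a)
    (h2 : residueCount 2 f = b + 1) : HasOption (star f) (ofCounts (a + 1) b) := by
  obtain ⟨i, hi⟩ := exists_mod_three_eq_of_residueCount_eq_succ h2
  exact hasOption_of_shorten i (.inl rfl) (by omega) (by split_ifs <;> omega)
    (by split_ifs <;> omega)

theorem hasOption_of_residueCount_eq_zero (h1 : residueCount 1 f = 0)
    (h2 : residueCount 2 f = 0) (hf : f ≠ 0) :
    HasOption (star f) (ofCounts 0 1) ∧ HasOption (star f) (ofCounts 1 0) := by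
  obtain ⟨i, hi : f i ≠ 0⟩ := Function.ne_iff.1 hf
  have hi1 := mod_three_ne_of_residueCount_eq_zero h1 i
  have hi2 := mod_three_ne_of_residueCount_eq_zero h2 i
  exact ⟨hasOption_of_shorten i (.inl rfl) (by omega) (by split_ifs <;> omega)
      (by split_ifs <;> omega),
    hasOption_of_shorten i (.inr rfl) (by omega) (by split_ifs <;> omega)
      (by split_ifs <;> omega)⟩

theorem hasOption_c0_of_residueCount (h1 : residueCount 1 f = 1) (h2 : residueCount 2 f = 0) :
    HasOption (star f) c0 := by
  by_cases hf : ∑ i, f i ≤ 1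
  · exact ⟨empty, .clear f hf, rfl⟩
  · have hlong : ∃ i, f i / 3 ≠ 0 := by
      by_contra! h0
      have hsum := sum_eq_residueCount f
      simp only [h0, Finset.sum_const_zero] at hsum
      omega
    obtain ⟨i, hi⟩ := hlong
    have hi2 := mod_three_ne_of_residueCount_eq_zero h2 i
    by_cases hi1 : f i % 3 = 1
    · exact hasOption_of_shorten (a := 0) (b := 1) i (.inr rfl) (by omega)
        (by split_ifs <;> omega) (by split_ifs <;> omega)
    · exact hasOption_of_shorten (a := 2) (b := 0) i (.inr rfl) (by omega)
        (by split_ifs <;> omega) (by split_ifs <;> omega)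

theorem exists_hasOption_of_mem_forcedOptions {x : Side ι} (hx : x ≠ star 0) :
    ∀ l ∈ forcedOptions x.starClass, ∃ c ∈ l, HasOption x c := by
  rcases x with _ | f
  · simp [starClass, forcedOptions]
  have hf : f ≠ 0 := fun h => hx (h ▸ rfl)
  intro l hl
  rcases h1 : residueCount 1 f with _ | _ | a <;> rcases h2 : residueCount 2 f with _ | b <;>
    rw [starClass, h1, h2] at hl
  · obtain ⟨h01, h10⟩ := hasOption_of_residueCount_eq_zero h1 h2 hf
    have : ofCounts 0 1 ∈ l ∨ ofCounts 1 0 ∈ l := by revert l; decide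
    rcases this with h | h
    exacts [⟨_, h, h01⟩, ⟨_, h, h10⟩]
  · rcases ofCounts_mem_of_mem_forcedOptions_zero_succ b l hl with h | h
    exacts [⟨_, h, hasOption_of_residueCount_two h1 h2⟩,
      ⟨_, h, hasOption_succ_of_residueCount_two h1 h2⟩]
  · have : c0 ∈ l ∨ ofCounts 0 0 ∈ l := by revert l; decide
    rcases this with h | h
    exacts [⟨_, h, hasOption_c0_of_residueCount h1 h2⟩,
      ⟨_, h, hasOption_of_residueCount_one h1 h2⟩]
  · rcases ofCounts_mem_of_mem_forcedOptions_succ_succ 0 b l hl with h | h | h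
    exacts [⟨_, h, hasOption_of_residueCount_one h1 h2⟩,
      ⟨_, h, hasOption_of_residueCount_two h1 h2⟩,
      ⟨_, h, hasOption_succ_of_residueCount_two h1 h2⟩]
  · exact ⟨_, ofCounts_mem_of_mem_forcedOptions_succ_zero a l hl,
      hasOption_of_residueCount_one h1 h2⟩
  · rcases ofCounts_mem_of_mem_forcedOptions_succ_succ (a + 1) b l hl with h | h | h
    exacts [⟨_, h, hasOption_of_residueCount_one h1 h2⟩,
      ⟨_, h, hasOption_of_residueCount_two h1 h2⟩,
      ⟨_, h, hasOption_succ_of_residueCount_two h1 h2⟩]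

theorem move_star_zero : Move (star 0 : Side ι) empty := .clear 0 (by simp)

theorem exists_move_of_lt_pairValue_c1s {x : Side ι} (hx : x ≠ star 0) {n : ℕ}
    (hn : n < pairValue x.starClass c1s) :
    (∃ y, Move x y ∧ pairValue y.starClass c1s = n) ∨ pairValue x.starClass c0 = n := by
  rcases exists_forcedOptions_of_lt_c1s _ n hn with h | ⟨l, hl, h⟩
  · exact .inr h
  · obtain ⟨_, hc, y, hy, rfl⟩ := exists_hasOption_of_mem_forcedOptions hx l hl
    exact .inl ⟨y, hy, h _ hc⟩

theorem exists_move_of_lt_pairValue {x : Side ι} {x' : Side κ} {n : ℕ}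
    (hn : n < pairValue x.starClass x'.starClass) (h0 : ¬ (x = star 0 ∧ x' = star 0)) :
    (∃ y, Move x y ∧ pairValue y.starClass x'.starClass = n) ∨
      ∃ y', Move x' y' ∧ pairValue x.starClass y'.starClass = n := by
  by_cases hx : x = star 0
  · have hx' : x' ≠ star 0 := fun h => h0 ⟨hx, h⟩
    subst hx
    rw [starClass_star_zero, pairValue_comm] at hn
    simp only [starClass_star_zero, pairValue_comm c1s]
    rcases exists_move_of_lt_pairValue_c1s hx' hn with h | h
    · exact .inr h
    · exact .inl ⟨empty, move_star_zero, by rwa [pairValue_comm]⟩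
  by_cases hx' : x' = star 0
  · subst hx'
    rw [starClass_star_zero] at hn ⊢
    exact (exists_move_of_lt_pairValue_c1s hx hn).imp_right fun h => ⟨empty, move_star_zero, h⟩
  rcases exists_forcedOptions_of_lt _ _ n hn with ⟨l, hl, h⟩ | ⟨l, hl, h⟩
  · obtain ⟨_, hc, y, hy, rfl⟩ := exists_hasOption_of_mem_forcedOptions hx l hl
    exact .inl ⟨y, hy, h _ hc⟩
  · obtain ⟨_, hc, y', hy', rfl⟩ := exists_hasOption_of_mem_forcedOptions hx' l hl
    exact .inr ⟨y', hy', h _ hc⟩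

end Side

section InfiniteSpider

open SimpleGraph

variable {ι : Type}

/-- The vertex at distance `n` from the centre `none` on the leg `i` of the infinite spider. -/
def legVertex (i : ι) : ℕ → Option (Σ _ : ι, ℕ)
  | 0 => none
  | n + 1 => some ⟨i, n⟩

/-- The spider with an infinite leg for every `i : ι`; its centre is `none`, and `some ⟨i, n⟩` is
the vertex at distance `n + 1` from the centre on the leg `i`. -/
def infiniteSpider (ι : Type) : SimpleGraph (Option (Σ _ : ι, ℕ)) :=
  SimpleGraph.fromRel fun u v => ∃ i n, u = legVertex i n ∧ v = legVertex i (n + 1)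

theorem legVertex_injective (i : ι) : Function.Injective (legVertex i) := by
  rintro (_ | m) (_ | n) h <;> simp_all [legVertex]

theorem infiniteSpider_adj_none_some {i : ι} {n : ℕ} :
    (infiniteSpider ι).Adj none (some ⟨i, n⟩) ↔ n = 0 := by
  simp only [infiniteSpider, fromRel_adj]
  constructor
  · rintro ⟨-, ⟨k, _ | m, hm, h⟩ | ⟨k, m, -, h⟩⟩ <;> cases h
    · rfl
    · cases hm
  · rintro rfl
    exact ⟨by simp, .inl ⟨i, 0, rfl, rfl⟩⟩

theorem infiniteSpider_adj_some_some {i k : ι} {m n : ℕ} :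
    (infiniteSpider ι).Adj (some ⟨i, m⟩) (some ⟨k, n⟩) ↔ i = k ∧ (m + 1 = n ∨ n + 1 = m) := by
  simp only [infiniteSpider, fromRel_adj]
  constructor
  · rintro ⟨-, ⟨k, _ | l, hl, h⟩ | ⟨k, _ | l, hl, h⟩⟩ <;> cases hl <;> cases h <;> simp
  · rintro ⟨rfl, rfl | rfl⟩
    · exact ⟨by simp, .inl ⟨i, m + 1, rfl, rfl⟩⟩
    · exact ⟨by simp, .inr ⟨i, n + 1, rfl, rfl⟩⟩

theorem infiniteSpider_adj_legVertex {i : ι} {m n : ℕ} :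
    (infiniteSpider ι).Adj (legVertex i m) (legVertex i n) ↔ (hasse ℕ).Adj m n := by
  rcases m with _ | m <;> rcases n with _ | n <;>
    simp only [legVertex, (infiniteSpider ι).adj_comm _ none, infiniteSpider_adj_none_some,
      infiniteSpider_adj_some_some, SimpleGraph.irrefl, hasse_adj, Nat.covBy_iff_add_one_eq,
      true_and] <;> omega

end InfiniteSpider

namespace Side

variable {ι : Type} [Fintype ι]

/-- The vertices of a side, as a set of vertices of the infinite spider. -/
def support : Side ι → Finset (Option (Σ _ : ι, ℕ))
  | empty => ∅
  | star f => Finset.insertNone (Finset.univ.sigma fun i => Finset.range (f i))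

variable {x y : Side ι} {f f' : ι → ℕ}

theorem none_mem_support : none ∈ x.support ↔ ∃ f, x = star f := by
  cases x <;> simp [support]

theorem eq_empty_of_none_notMem_support (h : none ∉ x.support) : x = empty := by
  cases x with
  | empty => rfl
  | star f => exact absurd (none_mem_support.2 ⟨f, rfl⟩) h

theorem some_mem_support_star {i : ι} {n : ℕ} : some ⟨i, n⟩ ∈ (star f).support ↔ n < f i := by
  simp [support]

theorem card_support_star : (star f).support.card = 1 + ∑ i, f i := by
  simp [support, Finset.card_insertNone, add_comm]

theorem support_injective : Function.Injective (support (ι := ι)) := by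
  intro x y h
  have hnone : none ∈ x.support ↔ none ∈ y.support := by rw [h]
  rcases x with _ | f <;> rcases y with _ | f'
  · rfl
  · simp [none_mem_support] at hnone
  · simp [none_mem_support] at hnone
  · congr 1
    ext i
    refine eq_of_forall_lt_iff fun n => ?_
    rw [← some_mem_support_star, h, some_mem_support_star]

theorem support_star_zero : (star 0 : Side ι).support = {none} := by
  ext (_ | ⟨i, n⟩) <;> simp [support]

variable [DecidableEq ι]

theorem card_support_star_update_zero (i : ι) :
    (star (Function.update f i 0)).support.card + f i = (star f).support.card := by
  rw [card_support_star, card_support_star, Finset.sum_update_of_mem (Finset.mem_univ i),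
    ← Finset.add_sum_erase _ f (Finset.mem_univ i), Finset.sdiff_singleton_eq_erase]
  omega

theorem removesVertexOrEdge_empty (hf : ∑ i, f i ≤ 1) :
    RemovesVertexOrEdge (infiniteSpider ι) (star f).support ∅ := by
  have hcard : (star f).support.card ≤ 2 := by
    rw [card_support_star]
    omega
  have hnone : none ∈ (star f).support := none_mem_support.2 ⟨f, rfl⟩
  by_cases h0 : ∃ i, f i ≠ 0
  · obtain ⟨i, hi⟩ := h0
    have hsome : some ⟨i, 0⟩ ∈ (star f).support := some_mem_support_star.2 (Nat.pos_of_ne_zero hi)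
    have hpair : {none, some ⟨i, 0⟩} = (star f).support :=
      Finset.eq_of_subset_of_card_le
        (Finset.insert_subset hnone (Finset.singleton_subset_iff.2 hsome))
        (by simpa [Finset.card_pair] using hcard)
    exact ⟨_, hnone, _, hsome, .inr (infiniteSpider_adj_none_some.2 rfl), by simp [hpair]⟩
  · push Not at h0
    exact ⟨none, hnone, none, hnone, .inl rfl, by
      ext (_ | ⟨i, n⟩) <;> simp [support, h0]⟩

theorem Move.removesVertexOrEdge (h : Move x y) :
    RemovesVertexOrEdge (infiniteSpider ι) x.support y.support := by
  rcases h with ⟨f, i, d, hd, hdi⟩ | ⟨f, hf⟩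
  · refine ⟨some ⟨i, f i - 1⟩, some_mem_support_star.2 (by omega), some ⟨i, f i - d⟩,
      some_mem_support_star.2 (by omega), ?_, ?_⟩
    · rw [infiniteSpider_adj_some_some]
      rcases hd with rfl | rfl
      · exact .inl rfl
      · exact .inr ⟨rfl, by omega⟩
    · ext v
      rcases v with _ | ⟨k, n⟩
      · simp [support]
      · rw [some_mem_support_star, Finset.mem_sdiff, some_mem_support_star]
        rcases eq_or_ne k i with rfl | hk
        · simp
          omega
        · simp [hk]
  · exact removesVertexOrEdge_empty hf

theorem move_of_removesVertexOrEdge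
    (h : RemovesVertexOrEdge (infiniteSpider ι) x.support y.support) : Move x y := by
  have hcard := h.card_eq
  obtain ⟨u, hu, v, hv, huv, hy⟩ := h
  rcases x with _ | f
  · simp [support] at hu
  rcases y with _ | f'
  · refine .clear f ?_
    rw [card_support_star, support, Finset.card_empty] at hcard
    omega
  have hmem : ∀ w, w ∈ (star f').support ↔ w ∈ (star f).support ∧ w ≠ u ∧ w ≠ v := by
    simp [hy]
  obtain ⟨-, hu0, hv0⟩ := (hmem none).1 (none_mem_support.2 ⟨f', rfl⟩)
  obtain ⟨⟨i, m⟩, rfl⟩ := Option.ne_none_iff_exists'.1 hu0.symm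
  obtain ⟨⟨k, n⟩, rfl⟩ := Option.ne_none_iff_exists'.1 hv0.symm
  obtain rfl : i = k := by
    rcases huv with h | h
    · cases h; rfl
    · exact (infiniteSpider_adj_some_some.1 h).1
  have hf' : f' = Function.update f i (f' i) := by
    refine Function.eq_update_iff.2 ⟨rfl, fun k hk => eq_of_forall_lt_iff fun n => ?_⟩
    rw [← some_mem_support_star, hmem, some_mem_support_star]
    simp [hk]
  have hcard0 := card_support_star_update_zero (f := f) i
  have hcard1 := card_support_star_update_zero (f := f') i
  have h0 : Function.update f' i 0 = Function.update f i 0 := by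
    rw [hf', Function.update_idem]
  rw [h0] at hcard1
  have hle : f i = f' i + 1 ∨ f i = f' i + 2 := by omega
  rw [hf', show f' i = f i - (f i - f' i) by omega]
  exact .shorten f i _ (by omega) (by omega)

end Side

section Bispider

open SimpleGraph

variable {ι : Bool → Type}

/-- Two infinite spiders, one for each side of a bistar, with an edge joining their centres. -/
def bispider (ι : Bool → Type) : SimpleGraph (Σ s, Option (Σ _ : ι s, ℕ)) where
  Adj u v := (∃ s a b, (infiniteSpider (ι s)).Adj a b ∧ u = ⟨s, a⟩ ∧ v = ⟨s, b⟩) ∨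
    (u.1 ≠ v.1 ∧ u.2 = none ∧ v.2 = none)
  symm := ⟨by
    rintro _ _ (⟨s, a, b, h, rfl, rfl⟩ | ⟨h, hu, hv⟩)
    exacts [.inl ⟨s, b, a, h.symm, rfl, rfl⟩, .inr ⟨h.symm, hv, hu⟩]⟩
  loopless := ⟨by
    rintro _ (⟨s, a, b, h, rfl, h'⟩ | ⟨h, -⟩)
    · cases h'
      exact h.ne rfl
    · exact h rfl⟩

theorem bispider_adj_same_side {s : Bool} {a b : Option (Σ _ : ι s, ℕ)} :
    (bispider ι).Adj ⟨s, a⟩ ⟨s, b⟩ ↔ (infiniteSpider (ι s)).Adj a b := by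
  constructor
  · rintro (⟨t, a, b, h, hu, hv⟩ | ⟨h, -⟩)
    · cases hu
      cases hv
      exact h
    · exact absurd rfl h
  · exact fun h => .inl ⟨s, a, b, h, rfl, rfl⟩

theorem bispider_adj_of_ne {s t : Bool} (hst : s ≠ t) {a : Option (Σ _ : ι s, ℕ)}
    {b : Option (Σ _ : ι t, ℕ)} : (bispider ι).Adj ⟨s, a⟩ ⟨t, b⟩ ↔ a = none ∧ b = none := by
  constructor
  · rintro (⟨t, a, b, h, hu, hv⟩ | ⟨-, h⟩)
    · cases hu
      cases hv
      exact absurd rfl hst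
    · exact h
  · exact fun h => .inr ⟨hst, h⟩

/-- A leg of the bispider, as an infinite path starting at the centre. -/
def legEmbedding (s : Bool) (i : ι s) : hasse ℕ ↪g bispider ι where
  toFun n := ⟨s, legVertex i n⟩
  inj' _ _ h := legVertex_injective i (eq_of_heq (Sigma.mk.inj h).2)
  map_rel_iff' := bispider_adj_same_side.trans infiniteSpider_adj_legVertex

theorem bispider_adj_some {s : Bool} {i : ι s} {n : ℕ} {v : Σ s, Option (Σ _ : ι s, ℕ)}
    (h : (bispider ι).Adj ⟨s, some ⟨i, n⟩⟩ v) :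
    v = ⟨s, legVertex i n⟩ ∨ v = ⟨s, some ⟨i, n + 1⟩⟩ := by
  obtain ⟨t, b⟩ := v
  rcases eq_or_ne s t with rfl | hst
  · rw [bispider_adj_same_side] at h
    rcases b with _ | ⟨k, m⟩
    · rw [adj_comm, infiniteSpider_adj_none_some] at h
      exact .inl (by rw [h, legVertex])
    · obtain ⟨rfl, rfl | rfl⟩ := infiniteSpider_adj_some_some.1 h
      exacts [.inr rfl, .inl rfl]
  · exact absurd ((bispider_adj_of_ne hst).1 h).1 (by simp)

variable {B : Finset (Σ s, Option (Σ _ : ι s, ℕ))}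

theorem mem_leg_of_legVertex_notMem (hB : ((bispider ι).induce (B : Set _)).Preconnected) {s : Bool}
    {i : ι s} {n : ℕ} (hn : ⟨s, some ⟨i, n⟩⟩ ∈ B) (hn' : ⟨s, legVertex i n⟩ ∉ B) :
    ∀ v ∈ B, ∃ m, v = ⟨s, some ⟨i, m⟩⟩ := by
  rw [induce_preconnected_iff_forall_cut] at hB
  suffices hcut : ∀ u ∈ B, ∀ v ∈ B, (bispider ι).Adj u v →
      (∃ m ≥ n, u = ⟨s, some ⟨i, m⟩⟩) → ∃ m ≥ n, v = ⟨s, some ⟨i, m⟩⟩ from fun v hv =>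
    (hB (fun v => ∃ m ≥ n, v = ⟨s, some ⟨i, m⟩⟩) hcut _ hn v hv ⟨n, le_rfl, rfl⟩).imp
      fun _ => And.right
  rintro _ - v hv hadj ⟨m, hm, rfl⟩
  rcases bispider_adj_some hadj with rfl | rfl
  · rcases hm.eq_or_lt with rfl | hlt
    · exact absurd hv hn'
    · obtain ⟨m, rfl⟩ := Nat.exists_eq_succ_of_ne_zero (Nat.ne_zero_of_lt hlt)
      exact ⟨m, Nat.le_of_lt_succ hlt, rfl⟩
  · exact ⟨m + 1, Nat.le_succ_of_le hm, rfl⟩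

theorem grundy_code033_of_subset_leg [∀ s, DecidableEq (ι s)]
    (hB : ((bispider ι).induce (B : Set _)).Preconnected) {s : Bool} {i : ι s}
    (hleg : ∀ v ∈ B, ∃ m, v = ⟨s, some ⟨i, m⟩⟩) :
    (octalGame code033 (bispider ι)).grundy B = B.card % 3 := by
  obtain ⟨C, rfl⟩ : ∃ C : Finset ℕ, C.map (legEmbedding s i).toEmbedding = B := by
    have hsub : (B : Set _) ⊆ Set.range (legEmbedding s i) := fun v hv => by
      obtain ⟨m, rfl⟩ := hleg v hv
      exact ⟨m + 1, rfl⟩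
    obtain ⟨C, -, hC⟩ := Finset.subset_set_image_iff.1 (Set.image_univ ▸ hsub)
    exact ⟨C, (Finset.map_eq_image _ _).trans hC⟩
  rw [grundy_octalGame_map, Finset.card_map, grundy_code033_of_induce_hasse_preconnected]
  rw [Finset.coe_map] at hB
  exact ((induceImageIso (legEmbedding s i) (C : Set ℕ)).preconnected_iff).2 hB

end Bispider

section Position

open SimpleGraph

variable {ι : Bool → Type} [∀ s, Fintype (ι s)]

/-- The position of the game on the bispider with the given sides. -/
def position (x : ∀ s, Side (ι s)) : Finset (Σ s, Option (Σ _ : ι s, ℕ)) :=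
  Finset.univ.sigma fun s => (x s).support

variable {x y : ∀ s, Side (ι s)}

theorem mem_position {s : Bool} {a : Option (Σ _ : ι s, ℕ)} :
    ⟨s, a⟩ ∈ position x ↔ a ∈ (x s).support := by
  simp [position]

theorem card_position (s : Bool) :
    (position x).card = (x s).support.card + (x (!s)).support.card := by
  rw [position, Finset.card_sigma, Fintype.sum_bool]
  cases s
  exacts [add_comm .., rfl]

theorem induce_position_preconnected (x : ∀ s, Side (ι s)) :
    ((bispider ι).induce (position x : Set _)).Preconnected := by
  rw [induce_preconnected_iff_forall_cut]
  intro p hp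
  have hiff : ∀ u ∈ position x, ∀ v ∈ position x, (bispider ι).Adj u v → (p u ↔ p v) :=
    fun u hu v hv h => ⟨hp u hu v hv h, hp v hv u hu h.symm⟩
  have hcenter : ∀ v ∈ position x, ⟨v.1, none⟩ ∈ position x ∧ (p v ↔ p ⟨v.1, none⟩) := by
    rintro ⟨s, a⟩ hv
    rcases hs : x s with _ | f
    · simp [mem_position, hs, Side.support] at hv
    have hmem : ∀ b, ⟨s, b⟩ ∈ position x ↔ b ∈ (Side.star f).support := fun b => by
      rw [mem_position, hs]
    have hnone : ⟨s, none⟩ ∈ position x := (hmem _).2 (Side.none_mem_support.2 ⟨f, rfl⟩)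
    refine ⟨hnone, ?_⟩
    rcases a with _ | ⟨i, n⟩
    · rfl
    rw [hmem, Side.some_mem_support_star] at hv
    induction n with
    | zero =>
      exact hiff _ ((hmem _).2 (Side.some_mem_support_star.2 hv)) _ hnone
        (bispider_adj_same_side.2 (infiniteSpider_adj_none_some.2 rfl).symm)
    | succ n ih =>
      exact (hiff _ ((hmem _).2 (Side.some_mem_support_star.2 hv)) _
        ((hmem _).2 (Side.some_mem_support_star.2 (by omega)))
        (bispider_adj_same_side.2 (infiniteSpider_adj_some_some.2 ⟨rfl, .inr rfl⟩))).trans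
          (ih (by omega))
  intro u hu v hv hpu
  obtain ⟨hu', hpu'⟩ := hcenter u hu
  obtain ⟨hv', hpv'⟩ := hcenter v hv
  rw [hpv']
  rw [hpu'] at hpu
  rcases eq_or_ne u.1 v.1 with h | h
  · rwa [← h]
  · exact (hiff _ hu' _ hv' ((bispider_adj_of_ne h).2 ⟨rfl, rfl⟩)).1 hpu

theorem exists_forall_mem_iff_lt {A : Set ℕ} (hA : IsLowerSet A) (hfin : A.Finite) :
    ∃ m, ∀ n, n ∈ A ↔ n < m := by
  rcases hA.eq_univ_or_Iio with rfl | ⟨m, rfl⟩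
  · exact absurd hfin Set.infinite_univ
  · exact ⟨m, fun _ => Iff.rfl⟩

theorem exists_side_of_forall_legVertex_mem {s : Bool} {B : Finset (Σ s, Option (Σ _ : ι s, ℕ))}
    (hB : ∀ i n, ⟨s, some ⟨i, n⟩⟩ ∈ B → ⟨s, legVertex i n⟩ ∈ B) :
    ∃ y : Side (ι s), ∀ a, a ∈ y.support ↔ ⟨s, a⟩ ∈ B := by
  by_cases hnone : ⟨s, none⟩ ∈ B
  · have hlength : ∀ i, ∃ m, ∀ n, (⟨s, some ⟨i, n⟩⟩ : Σ s, Option (Σ _ : ι s, ℕ)) ∈ B ↔ n < m := by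
      intro i
      refine exists_forall_mem_iff_lt (A := {n | ⟨s, some ⟨i, n⟩⟩ ∈ B}) ?_ ?_
      · intro n m hmn hn
        induction n, hmn using Nat.le_induction with
        | base => exact hn
        | succ n _ ih => exact ih (hB i (n + 1) hn)
      · refine Set.Finite.preimage
          (f := fun n => (⟨s, some ⟨i, n⟩⟩ : Σ s, Option (Σ _ : ι s, ℕ))) ?_ B.finite_toSet
        exact fun m _ n _ h => by simpa using h
    choose f hf using hlength
    refine ⟨.star f, ?_⟩
    rintro (_ | ⟨i, n⟩)
    · simpa [Side.none_mem_support] using hnone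
    · rw [Side.some_mem_support_star, hf]
  · refine ⟨.empty, ?_⟩
    have hsome : ∀ i n, (⟨s, some ⟨i, n⟩⟩ : Σ s, Option (Σ _ : ι s, ℕ)) ∉ B := by
      intro i n
      induction n with
      | zero => exact fun h => hnone (hB i 0 h)
      | succ n ih => exact fun h => ih (hB i (n + 1) h)
    rintro (_ | ⟨i, n⟩)
    · simpa [Side.support] using hnone
    · simpa [Side.support] using hsome i n

theorem exists_position_eq_or_subset_leg {B : Finset (Σ s, Option (Σ _ : ι s, ℕ))}
    (hB : ((bispider ι).induce (B : Set _)).Preconnected) :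
    (∃ x, position x = B) ∨ ∃ s i, ∀ v ∈ B, ∃ m, v = ⟨s, some ⟨i, m⟩⟩ := by
  by_cases hgap : ∃ s i n, ⟨s, some ⟨i, n⟩⟩ ∈ B ∧ ⟨s, legVertex i n⟩ ∉ B
  · obtain ⟨s, i, n, hn, hn'⟩ := hgap
    exact .inr ⟨s, i, mem_leg_of_legVertex_notMem hB hn hn'⟩
  · push Not at hgap
    choose x hx using fun s => exists_side_of_forall_legVertex_mem (hgap s)
    exact .inl ⟨x, by
      ext ⟨s, a⟩
      rw [mem_position, hx]⟩

variable [∀ s, DecidableEq (ι s)]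

theorem removesVertexOrEdge_position_update {s : Bool} {y : Side (ι s)} (h : (x s).Move y) :
    RemovesVertexOrEdge (bispider ι) (position x) (position (Function.update x s y)) := by
  obtain ⟨u, hu, v, hv, huv, hy⟩ := h.removesVertexOrEdge
  refine ⟨⟨s, u⟩, mem_position.2 hu, ⟨s, v⟩, mem_position.2 hv, ?_, ?_⟩
  · exact huv.imp (congrArg _) bispider_adj_same_side.2
  · ext ⟨t, a⟩
    rw [mem_position, Finset.mem_sdiff, mem_position]
    rcases eq_or_ne t s with rfl | hts
    · simp [hy]
    · simp [hts]

theorem mem_support_iff_of_position_eq_sdiff {u v : Σ s, Option (Σ _ : ι s, ℕ)}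
    (h : position y = position x \ {u, v}) {s : Bool} {a : Option (Σ _ : ι s, ℕ)} :
    a ∈ (y s).support ↔ a ∈ (x s).support ∧ ⟨s, a⟩ ≠ u ∧ ⟨s, a⟩ ≠ v := by
  rw [← mem_position, h, Finset.mem_sdiff, mem_position]
  simp

theorem eq_star_zero_and_eq_empty_of_position_eq_sdiff {s t : Bool} (hst : s ≠ t)
    (hs : none ∈ (x s).support) (ht : none ∈ (x t).support)
    (h : position y = position x \ {⟨s, none⟩, ⟨t, none⟩}) :
    (x = fun _ => .star 0) ∧ y = fun _ => .empty := by
  have hside : ∀ r, r = s ∨ r = t := by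
    revert hst
    cases s <;> cases t <;> decide
  have hy : ∀ r, y r = .empty := fun r => Side.eq_empty_of_none_notMem_support fun hr => by
    obtain ⟨-, hrs, hrt⟩ := (mem_support_iff_of_position_eq_sdiff h).1 hr
    rcases hside r with rfl | rfl
    exacts [hrs rfl, hrt rfl]
  refine ⟨funext fun r => Side.support_injective ?_, funext hy⟩
  rw [Side.support_star_zero]
  ext (_ | p)
  · rcases hside r with rfl | rfl
    exacts [iff_of_true hs (by simp), iff_of_true ht (by simp)]
  · refine iff_of_false (fun hp => ?_) (by simp)
    have hmem := (mem_support_iff_of_position_eq_sdiff h).2 ⟨hp, by rintro ⟨⟩, by rintro ⟨⟩⟩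
    simp [hy, Side.support] at hmem

theorem exists_move_or_star_zero_of_removesVertexOrEdge
    (h : RemovesVertexOrEdge (bispider ι) (position x) (position y)) :
    (∃ s z, (x s).Move z ∧ y = Function.update x s z) ∨
      (x = fun _ => .star 0) ∧ y = fun _ => .empty := by
  obtain ⟨⟨s, u⟩, hu, ⟨t, v⟩, hv, huv, hy⟩ := h
  rw [mem_position] at hu hv
  rcases eq_or_ne s t with rfl | hst
  · refine .inl ⟨s, y s, Side.move_of_removesVertexOrEdge ⟨u, hu, v, hv, ?_, ?_⟩, ?_⟩
    · exact huv.imp (fun h => by simpa using h) bispider_adj_same_side.1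
    · ext a
      simp [mem_support_iff_of_position_eq_sdiff hy]
    · refine Function.eq_update_iff.2 ⟨rfl, fun r hr => Side.support_injective ?_⟩
      ext a
      simp [mem_support_iff_of_position_eq_sdiff hy, hr]
  · obtain ⟨rfl, rfl⟩ :=
      (bispider_adj_of_ne hst).1 (huv.resolve_left fun h => hst (by cases h; rfl))
    exact .inr (eq_star_zero_and_eq_empty_of_position_eq_sdiff hst hu hv hy)

end Position

section PositionValue

open SimpleGraph

variable {ι : Bool → Type} [∀ s, Fintype (ι s)]

/-- The Grundy value of the position with the given sides. -/
def positionValue (x : ∀ s, Side (ι s)) : ℕ :=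
  StarClass.pairValue (x true).starClass (x false).starClass

theorem positionValue_eq_pairValue (s : Bool) (x : ∀ s, Side (ι s)) :
    positionValue x = StarClass.pairValue (x s).starClass (x (!s)).starClass := by
  cases s
  exacts [StarClass.pairValue_comm _ _, rfl]

theorem positionValue_star_zero : positionValue (ι := ι) (fun _ => .star 0) = 2 := by
  rw [positionValue, Side.starClass_star_zero, Side.starClass_star_zero]
  rfl

theorem positionValue_empty : positionValue (ι := ι) (fun _ => .empty) = 0 := by
  rw [positionValue, Side.starClass, Side.starClass]
  rfl

variable {x : ∀ s, Side (ι s)}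

theorem positionValue_update (s : Bool) (y : Side (ι s)) :
    positionValue (Function.update x s y) =
      StarClass.pairValue y.starClass (x (!s)).starClass := by
  rw [positionValue_eq_pairValue s, Function.update_self,
    Function.update_of_ne (Bool.not_ne_self s)]

theorem card_le_of_subset_leg {B : Finset (Σ s, Option (Σ _ : ι s, ℕ))} {s : Bool} {i : ι s}
    {f : ι s → ℕ} (hf : x s = .star f) (hB : B ⊆ position x)
    (hleg : ∀ v ∈ B, ∃ m, v = ⟨s, some ⟨i, m⟩⟩) : B.card ≤ f i := by
  classical
  have hsub : B ⊆ (Finset.range (f i)).image fun m => ⟨s, some ⟨i, m⟩⟩ := by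
    intro v hv
    obtain ⟨m, rfl⟩ := hleg v hv
    have hm := mem_position.1 (hB hv)
    rw [hf, Side.some_mem_support_star] at hm
    exact Finset.mem_image_of_mem _ (Finset.mem_range.2 hm)
  simpa using (Finset.card_le_card hsub).trans Finset.card_image_le

variable [∀ s, DecidableEq (ι s)]

theorem positionValue_update_ne {s : Bool} {y : Side (ι s)} (h : (x s).Move y) :
    positionValue (Function.update x s y) ≠ positionValue x := by
  rw [positionValue_update, positionValue_eq_pairValue s]
  exact (h.separated _).symm

theorem exists_move_of_lt_positionValue {n : ℕ} (hn : n < positionValue x)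
    (h0 : x ≠ fun _ => .star 0) :
    ∃ s y, (x s).Move y ∧ positionValue (Function.update x s y) = n := by
  have h0' : ¬ (x true = .star 0 ∧ x false = .star 0) := fun h => h0 <| by
    funext s
    cases s
    exacts [h.2, h.1]
  rcases Side.exists_move_of_lt_pairValue hn h0' with ⟨y, hy, h⟩ | ⟨y, hy, h⟩
  · exact ⟨true, y, hy, (positionValue_update true y).trans h⟩
  · exact ⟨false, y, hy,
      (positionValue_update false y).trans ((StarClass.pairValue_comm ..).trans h)⟩

/-- Only small stars admit a move to a single leg, and for these the Grundy value is the one of a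
path with equally many vertices. -/
theorem positionValue_eq_card_mod_three {B : Finset (Σ s, Option (Σ _ : ι s, ℕ))} {s : Bool}
    {i : ι s} (hrem : RemovesVertexOrEdge (bispider ι) (position x) B) (hne : B.Nonempty)
    (hleg : ∀ v ∈ B, ∃ m, v = ⟨s, some ⟨i, m⟩⟩) : positionValue x = (position x).card % 3 := by
  obtain ⟨f, hf⟩ : ∃ f, x s = .star f := by
    obtain ⟨v, hv⟩ := hne
    obtain ⟨m, rfl⟩ := hleg v hv
    rcases hs : x s with _ | f
    · have hmem := mem_position.1 (hrem.subset hv)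
      simp [hs, Side.support] at hmem
    · exact ⟨f, rfl⟩
  have hleg_card := card_le_of_subset_leg hf hrem.subset hleg
  have hrest := Side.card_support_star_update_zero (f := f) i
  have hcard := hrem.card_eq
  have hsum := sum_eq_residueCount f
  rw [card_position s, hf] at hcard ⊢
  rw [positionValue_eq_pairValue s, hf]
  rw [Side.card_support_star] at hrest hcard ⊢
  rw [Side.card_support_star] at hrest
  rcases hs' : x (!s) with _ | f'
  · obtain ⟨h1, h2⟩ := residueCount_le_of_sum_update_zero_le (f := f) (i := i) (n := 1)
      (by omega)
    rw [Side.starClass, Side.starClass, StarClass.pairValue_c0,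
      StarClass.value_ofCounts_of_le h1 h2, Side.support, Finset.card_empty]
    omega
  · have hsum' := sum_eq_residueCount f'
    rw [hs', Side.card_support_star] at hcard
    obtain ⟨h1, h2⟩ := residueCount_le_of_sum_update_zero_le (f := f) (i := i) (n := 0)
      (by omega)
    rw [Side.starClass, Side.starClass,
      StarClass.pairValue_ofCounts_of_le_one h1 h2 (by omega) (by omega), Side.card_support_star]
    omega

theorem opt_position_update {s : Bool} {y : Side (ι s)} (h : (x s).Move y) :
    (octalGame code033 (bispider ι)).Opt (position x) (position (Function.update x s y)) :=
  (octalGame_code033_opt_iff (induce_position_preconnected x)).2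
    ⟨removesVertexOrEdge_position_update h, induce_position_preconnected _⟩

theorem exists_opt_of_lt_positionValue_star_zero {n : ℕ}
    (hn : n < positionValue (ι := ι) fun _ => .star 0) :
    ∃ y, (octalGame code033 (bispider ι)).Opt (position fun _ => .star 0) (position y) ∧
      positionValue y = n := by
  rw [positionValue_star_zero] at hn
  interval_cases n
  · refine ⟨fun _ => .empty, (octalGame_code033_opt_iff (induce_position_preconnected _)).2
      ⟨⟨⟨true, none⟩, ?_, ⟨false, none⟩, ?_, .inr ?_, ?_⟩, induce_position_preconnected _⟩,
      positionValue_empty⟩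
    · simp [mem_position, Side.support_star_zero]
    · simp [mem_position, Side.support_star_zero]
    · exact (bispider_adj_of_ne (by decide)).2 ⟨rfl, rfl⟩
    · ext ⟨s, _ | a⟩ <;> cases s <;> simp [mem_position, Side.support]
  · refine ⟨_, opt_position_update (s := true) Side.move_star_zero, ?_⟩
    rw [positionValue_update, Side.starClass_star_zero, Side.starClass]
    rfl

theorem grundy_position (x : ∀ s, Side (ι s)) :
    (octalGame code033 (bispider ι)).grundy (position x) = positionValue x := by
  refine ImpartialGame.grundy_eq_of_family position positionValue (fun x B hB => ?_)
    (fun x m hm => ?_) x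
  · obtain ⟨hrem, hpre⟩ := (octalGame_code033_opt_iff (induce_position_preconnected x)).1 hB
    by_cases hpos : ∃ y, position y = B
    · obtain ⟨y, rfl⟩ := hpos
      refine .inl ⟨y, rfl, ?_⟩
      rcases exists_move_or_star_zero_of_removesVertexOrEdge hrem with
        ⟨s, z, hz, rfl⟩ | ⟨rfl, rfl⟩
      · exact positionValue_update_ne hz
      · rw [positionValue_star_zero, positionValue_empty]
        decide
    · obtain ⟨s, i, hleg⟩ := (exists_position_eq_or_subset_leg hpre).resolve_left hpos
      have hne : B.Nonempty := Finset.nonempty_iff_ne_empty.2 fun h =>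
        hpos ⟨fun _ => .empty, by simp [h, position, Side.support]⟩
      right
      rw [grundy_code033_of_subset_leg hpre hleg, positionValue_eq_card_mod_three hrem hne hleg]
      have := hrem.card_eq
      omega
  · by_cases h0 : x = fun _ => .star 0
    · subst h0
      exact exists_opt_of_lt_positionValue_star_zero hm
    · obtain ⟨s, y, hy, he⟩ := exists_move_of_lt_positionValue hm h0
      exact ⟨_, opt_position_update hy, he⟩

end PositionValue

section Spider

open SimpleGraph

variable {ι : Type} (len : ι → ℕ+)

variable {len} in
theorem spider_adj_none_some {i : ι} {j : Fin (len i)} :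
    (spider len).Adj none (some ⟨i, j⟩) ↔ j.val = 0 := by
  rw [spider, fromRel_adj]
  constructor
  · rintro ⟨-, h | h⟩ <;> cases h
    assumption
  · exact fun h => ⟨by simp, .inl (.first i j h)⟩

variable {len} in
theorem spider_adj_some_some {i k : ι} {j : Fin (len i)} {l : Fin (len k)} :
    (spider len).Adj (some ⟨i, j⟩) (some ⟨k, l⟩) ↔
      i = k ∧ (j.val + 1 = l.val ∨ l.val + 1 = j.val) := by
  rw [spider, fromRel_adj]
  constructor
  · rintro ⟨-, h | h⟩ <;> cases h with | next _ _ _ h => simp [h]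
  · rintro ⟨rfl, h⟩
    have hne : j ≠ l := by
      rintro rfl
      omega
    exact ⟨by simpa using hne, h.imp (fun h => .next i j l h.symm) fun h => .next i l j h.symm⟩

/-- The spider with legs of lengths `len i`, inside the spider with infinite legs. -/
def spiderEmbedding : spider len ↪g infiniteSpider ι where
  toFun := Option.map fun p => ⟨p.1, p.2⟩
  inj' := by
    refine Option.map_injective ?_
    rintro ⟨i, j⟩ ⟨k, l⟩ h
    obtain rfl : i = k := congrArg Sigma.fst h
    exact congrArg _ (Fin.ext (eq_of_heq (Sigma.mk.inj h).2))
  map_rel_iff' := by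
    rintro (_ | ⟨i, j⟩) (_ | ⟨k, l⟩)
    · exact iff_of_false (SimpleGraph.irrefl _) (SimpleGraph.irrefl _)
    · exact infiniteSpider_adj_none_some.trans spider_adj_none_some.symm
    · rw [(spider len).adj_comm, (infiniteSpider ι).adj_comm]
      exact infiniteSpider_adj_none_some.trans spider_adj_none_some.symm
    · exact infiniteSpider_adj_some_some.trans spider_adj_some_some.symm

theorem map_univ_spiderEmbedding [Fintype ι] :
    Finset.univ.map (spiderEmbedding len).toEmbedding = (Side.star fun i => len i).support := by
  ext (_ | ⟨i, n⟩)
  · refine iff_of_true (Finset.mem_map.2 ⟨none, Finset.mem_univ _, rfl⟩)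
      (Side.none_mem_support.2 ⟨_, rfl⟩)
  · rw [Side.some_mem_support_star]
    constructor
    · intro h
      obtain ⟨_ | ⟨k, l⟩, -, h⟩ := Finset.mem_map.1 h <;> cases h
      exact l.isLt
    · exact fun h => Finset.mem_map.2 ⟨some ⟨i, ⟨n, h⟩⟩, Finset.mem_univ _, rfl⟩

end Spider

namespace SubdividedStar

/-- The multiset of path lengths, which is `0` for the empty graph. -/
def arms : SubdividedStar → Multiset ℕ+
  | empty => 0
  | star arms => arms

/-- The indices of the paths of a star, as in `SubdividedStar.Vertex`. -/
abbrev ArmIndex (S : SubdividedStar) : Type := S.arms.toEnumFinset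

/-- A subdivided star, regarded as one side of a bistar. -/
def side : (S : SubdividedStar) → Side S.ArmIndex
  | empty => .empty
  | star _ => .star fun p => p.1.1

/-- The class to which a subdivided star belongs. -/
def starClass (S : SubdividedStar) : StarClass := S.side.starClass

/-- A subdivided star, inside the spider with infinite legs. -/
def embedding : (S : SubdividedStar) → S.graph ↪g infiniteSpider S.ArmIndex
  | empty => ⟨⟨Empty.elim, fun v => v.elim⟩, fun {v} => v.elim⟩
  | star _ => spiderEmbedding _

variable (S S' : SubdividedStar)

theorem map_univ_embedding : Finset.univ.map S.embedding.toEmbedding = S.side.support := by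
  cases S with
  | empty => rfl
  | star arms => exact map_univ_spiderEmbedding _

theorem isCenter_iff_embedding_eq_none {v : S.Vertex} :
    S.IsCenter v ↔ S.embedding v = none := by
  cases S with
  | empty => exact v.elim
  | star arms => exact Option.map_eq_none_iff.symm

theorem bistar_adj_inl_inr {v : S.Vertex} {w : S'.Vertex} :
    (bistar S S').Adj (.inl v) (.inr w) ↔ S.IsCenter v ∧ S'.IsCenter w := by
  simp [bistar]

/-- A bistar, inside the bispider with infinite legs. -/
def bistarEmbedding : bistar S S' ↪g bispider fun s => (cond s S S').ArmIndex where
  toFun := Sum.elim (fun v => ⟨true, S.embedding v⟩) fun v => ⟨false, S'.embedding v⟩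
  inj' := by
    rintro (v | v) (w | w) h
    · exact congrArg _ (S.embedding.injective (eq_of_heq (Sigma.mk.inj h).2))
    · cases congrArg Sigma.fst h
    · cases congrArg Sigma.fst h
    · exact congrArg _ (S'.embedding.injective (eq_of_heq (Sigma.mk.inj h).2))
  map_rel_iff' := by
    have hcross : ∀ v w, (bispider fun s => (cond s S S').ArmIndex).Adj ⟨true, S.embedding v⟩
        ⟨false, S'.embedding w⟩ ↔ (bistar S S').Adj (.inl v) (.inr w) := fun v w => by
      rw [bistar_adj_inl_inr, isCenter_iff_embedding_eq_none, isCenter_iff_embedding_eq_none]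
      exact bispider_adj_of_ne (by decide)
    rintro (v | v) (w | w)
    · refine bispider_adj_same_side.trans (S.embedding.map_adj_iff.trans ?_)
      simp [bistar]
    · exact hcross v w
    · rw [(bistar S S').adj_comm, (bispider _).adj_comm]
      exact hcross w v
    · refine bispider_adj_same_side.trans (S'.embedding.map_adj_iff.trans ?_)
      simp [bistar]

theorem bistarEmbedding_inl (v : S.Vertex) :
    bistarEmbedding S S' (.inl v) = ⟨true, S.embedding v⟩ := rfl

theorem bistarEmbedding_inr (w : S'.Vertex) :
    bistarEmbedding S S' (.inr w) = ⟨false, S'.embedding w⟩ := rfl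

theorem map_univ_bistarEmbedding : Finset.univ.map (bistarEmbedding S S').toEmbedding =
    position fun s => (cond s S S').side := by
  ext ⟨s, a⟩
  rw [mem_position, Finset.mem_map]
  cases s
  · refine Iff.trans ?_ (Finset.ext_iff.1 S'.map_univ_embedding a)
    simp [bistarEmbedding_inl, bistarEmbedding_inr]
  · refine Iff.trans ?_ (Finset.ext_iff.1 S.map_univ_embedding a)
    simp [bistarEmbedding_inl, bistarEmbedding_inr]

theorem grundy_bistar :
    grundy033 (bistar S S') = StarClass.pairValue S.starClass S'.starClass := by
  rw [grundy033, ← grundy_octalGame_map (bistarEmbedding S S'), map_univ_bistarEmbedding,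
    grundy_position]
  rfl

theorem grundy_eq_value : S.grundy = S.starClass.value := by
  let φ : S.graph ↪g bistar S empty := ⟨.inl, by simp [bistar]⟩
  have hφ : Finset.univ.map φ.toEmbedding = Finset.univ := by
    ext (v | v)
    · exact iff_of_true (Finset.mem_map_of_mem φ.toEmbedding (Finset.mem_univ v))
        (Finset.mem_univ _)
    · exact v.elim
  rw [grundy, grundy033, ← grundy_octalGame_map φ, hφ, ← StarClass.pairValue_c0]
  exact grundy_bistar S empty

end SubdividedStar

namespace SubdividedStar

/-- The number of paths whose length is congruent to `r < 3` modulo 3. -/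
def armCount (r : ℕ) (S : SubdividedStar) : ℕ := S.arms.countP fun l : ℕ+ => (l : ℕ) % 3 = r

variable (m : Multiset ℕ+)

theorem residueCount_arms (S : SubdividedStar) (r : ℕ) :
    residueCount r (fun p : S.ArmIndex => (p.1.1 : ℕ)) = S.armCount r := by
  rw [residueCount_eq_sum, armCount, Finset.sum_coe_sort S.arms.toEnumFinset
    fun p => if (p.1 : ℕ) % 3 = r then 1 else 0, ← Finset.card_filter,
    Multiset.countP_eq_card_filter]
  conv_rhs => rw [← Multiset.map_toEnumFinset_fst S.arms, Multiset.filter_map, Multiset.card_map]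
  rfl

theorem starClass_star : (star m).starClass =
    StarClass.ofCounts ((star m).armCount 1) ((star m).armCount 2) := by
  rw [← residueCount_arms, ← residueCount_arms]
  rfl

/-- The star with `a` paths of length 1 and `b` paths of length 2. -/
def reducedStar (a b : ℕ) : SubdividedStar :=
  star (Multiset.replicate a 1 + Multiset.replicate b 2)

theorem reducedStar_inj {a b a' b' : ℕ} :
    reducedStar a b = reducedStar a' b' ↔ a = a' ∧ b = b' := by
  refine ⟨fun h => ?_, fun h => by rw [h.1, h.2]⟩
  have harms := SubdividedStar.star.inj h
  constructor
  · simpa [Multiset.count_replicate] using congrArg (Multiset.count 1) harms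
  · simpa [Multiset.count_replicate] using congrArg (Multiset.count 2) harms

theorem twos_reducedStar (a b : ℕ) : (reducedStar a b).twos = b := by
  simp [reducedStar, twos, Multiset.count_replicate]

theorem reduce_star :
    (star m).reduce = reducedStar ((star m).armCount 1) ((star m).armCount 2) := by
  simp only [reduce, reducedStar, armCount, arms, Multiset.pure_def, Multiset.bind_def,
    Multiset.bind_singleton, star.injEq]
  induction m using Multiset.induction with
  | empty => simp
  | cons l m ih =>
    have hmod : (l : ℕ) % 3 = 0 ∨ (l : ℕ) % 3 = 1 ∨ (l : ℕ) % 3 = 2 := by omega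
    rw [Multiset.map_cons]
    rcases hmod with h | h | h
    · rw [Multiset.filterMap_cons_none _ _ (by simp [h]), ih]
      simp [h]
    · rw [Multiset.filterMap_cons_some (b := 1) _ _ _ (by simp [h]), ih]
      simp [h, Multiset.replicate_succ]
    · rw [Multiset.filterMap_cons_some (b := 2) _ _ _ (by simp [h]), ih]
      simp [h, Multiset.replicate_succ]

theorem armCount_reducedStar (a b : ℕ) :
    (reducedStar a b).armCount 1 = a ∧ (reducedStar a b).armCount 2 = b := by
  have hreplicate : ∀ (n : ℕ) (x : ℕ+) (r : ℕ),
      ((Multiset.replicate n x).countP fun l : ℕ+ => (l : ℕ) % 3 = r) =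
        if (x : ℕ) % 3 = r then n else 0 := fun n x r => by
    rw [← Multiset.coe_replicate, Multiset.coe_countP, List.countP_replicate]
    simp
  simp [armCount, arms, reducedStar, hreplicate]

theorem starClass_reducedStar (a b : ℕ) :
    (reducedStar a b).starClass = StarClass.ofCounts a b := by
  rw [reducedStar, starClass_star, ← reducedStar, (armCount_reducedStar a b).1,
    (armCount_reducedStar a b).2]

theorem starClass_surjective : Function.Surjective starClass := by
  intro c
  cases c
  · exact ⟨empty, rfl⟩
  · exact ⟨reducedStar 3 0, starClass_reducedStar _ _⟩
  · exact ⟨reducedStar 0 0, starClass_reducedStar _ _⟩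
  · exact ⟨reducedStar 0 5, starClass_reducedStar _ _⟩
  · exact ⟨reducedStar 1 0, starClass_reducedStar _ _⟩
  · exact ⟨reducedStar 2 1, starClass_reducedStar _ _⟩
  · exact ⟨reducedStar 1 5, starClass_reducedStar _ _⟩
  · exact ⟨reducedStar 3 1, starClass_reducedStar _ _⟩

theorem sim1_iff_starClass_eq {S S' : SubdividedStar} :
    Sim1 S S' ↔ S.starClass = S'.starClass := by
  have hsim : Sim1 S S' ↔ ∀ T : SubdividedStar, StarClass.pairValue S.starClass T.starClass =
      StarClass.pairValue S'.starClass T.starClass := by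
    refine forall_congr' fun T => ?_
    rw [← grundy_bistar, ← grundy_bistar]
    exact ImpartialGame.equivalent_iff_grundy_eq ..
  rw [hsim, ← starClass_surjective.forall (p := fun d => StarClass.pairValue S.starClass d =
    StarClass.pairValue S'.starClass d), ← funext_iff, StarClass.pairValue_left_injective.eq_iff]

end SubdividedStar

namespace StarClass

open SubdividedStar

variable (m : Multiset ℕ+) (i : ℕ)

theorem star_mem_set1s : star m ∈ set1s ↔
    (cap 2 ((star m).armCount 1) = 0 ∧ cap 4 ((star m).armCount 2) = 0) ∨
    (cap 2 ((star m).armCount 1) = 1 ∧ cap 4 ((star m).armCount 2) = 1) ∨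
    (cap 2 ((star m).armCount 1) = 0 ∧ cap 4 ((star m).armCount 2) = 3) := by
  have h21 : SubdividedStar.star {2, 1} = reducedStar 1 1 :=
    congrArg SubdividedStar.star (by decide)
  rw [set1s, Set.mem_ofPred_eq, reduce_star, h21, show SubdividedStar.star 0 = reducedStar 0 0 from
    rfl, show SubdividedStar.star {2, 2, 2} = reducedStar 0 3 from rfl]
  simp [reducedStar_inj, cap_eq_iff]

theorem star_mem_set2s : star m ∈ set2s ↔
    (cap 2 ((star m).armCount 1) = 1 ∧ cap 4 ((star m).armCount 2) = 0) ∨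
    (cap 2 ((star m).armCount 1) = 0 ∧ cap 4 ((star m).armCount 2) = 2) := by
  rw [set2s, Set.mem_ofPred_eq, reduce_star, show SubdividedStar.star {1} = reducedStar 1 0 from
    rfl, show SubdividedStar.star {2, 2} = reducedStar 0 2 from rfl]
  simp [reducedStar_inj, cap_eq_iff]

theorem star_mem_setBox : star m ∈ setBox i ↔
    (ofCap (cap 2 ((star m).armCount 1)) (cap 4 ((star m).armCount 2))).value = i ∧
    (cap 4 ((star m).armCount 2) = 1 ∨ cap 4 ((star m).armCount 2) = 3) := by
  rw [setBox, Set.mem_ofPred_eq, reduce_star, twos_reducedStar, grundy_eq_value, starClass_star,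
    ofCounts]
  simp [cap_eq_iff]

theorem star_mem_setPlain : star m ∈ setPlain i ↔
    (ofCap (cap 2 ((star m).armCount 1)) (cap 4 ((star m).armCount 2))).value = i ∧
    star m ∉ set1s ∧ star m ∉ set2s ∧ star m ∉ setBox 2 ∧ star m ∉ setBox 3 := by
  rw [setPlain, Set.mem_ofPred_eq, grundy_eq_value, starClass_star, ofCounts]

theorem mem_toSet (c : StarClass) (S : SubdividedStar) : S ∈ c.toSet ↔ S.starClass = c := by
  cases S with
  | empty =>
    have hg : SubdividedStar.empty.grundy = 0 := grundy_eq_value .empty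
    have hc : SubdividedStar.empty.starClass = c0 := rfl
    cases c <;> simp [toSet, set1s, set2s, setBox, setPlain, reduce, twos, hg, hc]
  | star m =>
    rw [starClass_star, ofCounts]
    cases c <;>
      simp only [toSet, star_mem_setPlain, star_mem_set1s, star_mem_set2s, star_mem_setBox] <;>
      generalize cap 2 _ = x <;> generalize cap 4 _ = y <;> revert x y <;> decide

theorem toSet_injective : Function.Injective toSet := by
  intro c c' h
  obtain ⟨S, rfl⟩ := starClass_surjective c
  have hS : S ∈ toSet S.starClass := (mem_toSet _ _).2 rfl
  rw [h, mem_toSet] at hS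
  exact hS

end StarClass

namespace SubdividedStar

theorem equivalence_sim1 : Equivalence Sim1 := by
  have h : Sim1 = fun S S' => S.starClass = S'.starClass :=
    funext₂ fun _ _ => propext sim1_iff_starClass_eq
  rw [h]
  exact eq_equivalence.comap starClass

theorem classes_sim1 :
    Setoid.classes ⟨Sim1, equivalence_sim1⟩ = Set.range StarClass.toSet := by
  have hclass : ∀ T : SubdividedStar, {S | Sim1 S T} = T.starClass.toSet := by
    intro T
    ext S
    rw [Set.mem_ofPred_eq, sim1_iff_starClass_eq, StarClass.mem_toSet]
  ext X
  constructor
  · rintro ⟨T, rfl⟩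
    exact ⟨T.starClass, (hclass T).symm⟩
  · rintro ⟨c, rfl⟩
    obtain ⟨T, rfl⟩ := starClass_surjective c
    exact ⟨T, (hclass T).symm⟩

end SubdividedStar

theorem mainTheorem4 :
    (∃ h : Equivalence SubdividedStar.Sim1,
      Setoid.classes ⟨SubdividedStar.Sim1, h⟩ = Set.range StarClass.toSet) ∧
    Function.Injective StarClass.toSet ∧
    ∀ (c c' : StarClass), ∀ S ∈ c.toSet, ∀ S' ∈ c'.toSet,
      grundy033 (SubdividedStar.bistar S S') =
        (StarClass.table c c').getD (S.grundy ^^^ S'.grundy) := by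
  refine ⟨⟨SubdividedStar.equivalence_sim1, SubdividedStar.classes_sim1⟩,
    StarClass.toSet_injective, ?_⟩
  intro c c' S hS S' hS'
  rw [StarClass.mem_toSet] at hS hS'
  subst hS hS'
  rw [SubdividedStar.grundy_bistar, SubdividedStar.grundy_eq_value S,
    SubdividedStar.grundy_eq_value S', StarClass.pairValue]
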